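/- Let $\mathbf F$ be a finite field of odd characteristic and let $(W,\langle\ ,\ \rangle)$ be a finite-dimensional symplectic vector space over $\mathbf F$. Let $H(W)=W\oplus\mathbf F$ be its Heisenberg group, with law $(w,t)(w',t')=(w+w',\,t+t'+\tfrac12\langle w,w'\rangle)$, let $\chi$ be a non-trivial character of $\mathbf F$, and let $\rho_\chi$ be an irreducible complex representation of $H(W)$ with central character $\chi$. Let $\omega$ be an oscillator representation of $Sp(W)$, i.e. a representation on the space of $\rho_\chi$ with $\omega(g)\rho_\chi(w,t)\omega(g)^{-1}=\rho_\chi(g(w),t)$ for all $g\in Sp(W)$ and $(w,t)\in H(W)$. Let $2W=W\oplus W$ with the symplectic form $\langle(w_1,w_2),(w_1',w_2')\rangle_{2W}=\langle w_1,w_1'\rangle-\langle w_2,w_2'\rangle$. For a Lagrangian (maximal isotropic) subspace $\tilde L\subset 2W$ let $q(\tilde L)$ be the non-zero operator on the space of $\rho_\chi$, determined up to a non-zero scalar, with $\rho_\chi(w',0)\,q(\tilde L)\,\rho_\chi(-w,0)=q(\tilde L)$ for all $(w,w')\in\tilde L$. The oscillator semigroup $\mathfrak S(2W)$ is the set of all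 operators $q(\tilde L)$ (with all their non-zero scalar multiples), $\tilde L$ running over the Lagrangian subspaces of $2W$. Let $(G,G')$ be a dual pair in $Sp(W)$, i.e. $G$ and $G'$ are subgroups of $Sp(W)$ each of which is the full centralizer of the other. Then the set $\mathfrak S(2W)^G$ of those elements of $\mathfrak S(2W)$ that commute with $\omega(g)$ for every $g\in G$ is closed under multiplication, and its complex linear span is the commuting algebra of $\omega(G)$, that is, the algebra of all linear operators on the space of $\rho_\chi$ that commute with $\omega(g)$ for every $g\in G$. -/

import Mathlib

namespace Oscillator

section Symplectic

variable {F W : Type*} [Field F] [AddCommGroup W] [Module F W]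

/-- The symplectic group `Sp(W)`: linear automorphisms of `W` preserving the form `B`. -/
def Sp (B : LinearMap.BilinForm F W) : Subgroup (W ≃ₗ[F] W) where
  carrier := {g | ∀ x y, B (g x) (g y) = B x y}
  one_mem' := fun _ _ => rfl
  mul_mem' := by
    intro g h hg hh x y
    rw [LinearEquiv.mul_apply, LinearEquiv.mul_apply, hg, hh]
  inv_mem' := by
    intro g hg x y
    have h := hg (g⁻¹ x) (g⁻¹ y)
    rw [← LinearEquiv.mul_apply, ← LinearEquiv.mul_apply, mul_inv_cancel] at h
    exact h.symm

/-- A Lagrangian subspace: a subspace which is maximal among those on which the form vanishes. -/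
def IsLagrangian (B : LinearMap.BilinForm F W) (L : Submodule F W) : Prop :=
  Maximal (fun M : Submodule F W => ∀ x ∈ M, ∀ y ∈ M, B x y = 0) L

/-- The form of the signed double `2W = W ⊕ W`:
`⟨(w₁, w₂), (w₁', w₂')⟩ = ⟨w₁, w₁'⟩ - ⟨w₂, w₂'⟩`. -/
def doubleForm (B : LinearMap.BilinForm F W) : LinearMap.BilinForm F (W × W) :=
  B.compl₁₂ (LinearMap.fst F W W) (LinearMap.fst F W W) -
    B.compl₁₂ (LinearMap.snd F W W) (LinearMap.snd F W W)

/-- The underlying set `W ⊕ F` of the Heisenberg group of `(W, B)`. -/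
@[ext]
structure Heisenberg (B : LinearMap.BilinForm F W) where
  vec : W
  scal : F

namespace Heisenberg

variable {B : LinearMap.BilinForm F W}

/-- `(w, t) (w', t') = (w + w', t + t' + ½⟨w, w'⟩)`. -/
instance : Mul (Heisenberg B) :=
  ⟨fun a b => ⟨a.vec + b.vec, a.scal + b.scal + (2 : F)⁻¹ * B a.vec b.vec⟩⟩

instance : One (Heisenberg B) := ⟨⟨0, 0⟩⟩

/-- For an alternating form this is `(w, t)⁻¹ = (-w, -t)`. -/
instance : Inv (Heisenberg B) :=
  ⟨fun a => ⟨-a.vec, -a.scal + (2 : F)⁻¹ * B a.vec a.vec⟩⟩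

theorem mul_def (a b : Heisenberg B) :
    a * b = ⟨a.vec + b.vec, a.scal + b.scal + (2 : F)⁻¹ * B a.vec b.vec⟩ := rfl

theorem one_def : (1 : Heisenberg B) = ⟨0, 0⟩ := rfl

theorem inv_def (a : Heisenberg B) :
    a⁻¹ = ⟨-a.vec, -a.scal + (2 : F)⁻¹ * B a.vec a.vec⟩ := rfl

instance : Group (Heisenberg B) :=
  Group.ofLeftAxioms
    (by
      intro a b c
      simp only [mul_def, map_add, LinearMap.add_apply, Heisenberg.mk.injEq]
      exact ⟨add_assoc _ _ _, by ring⟩)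
    (by
      intro a
      simp [mul_def, one_def])
    (by
      intro a
      simp [mul_def, one_def, inv_def])

/-- The action of `Sp(W)` on the Heisenberg group by automorphisms: `g (w, t) = (g w, t)`. -/
def aut (g : Sp B) : Heisenberg B ≃* Heisenberg B where
  toFun a := ⟨(g : W ≃ₗ[F] W) a.vec, a.scal⟩
  invFun a := ⟨(g : W ≃ₗ[F] W).symm a.vec, a.scal⟩
  left_inv a := by simp
  right_inv a := by simp
  map_mul' a b := by
    simp only [mul_def, map_add, Heisenberg.mk.injEq, true_and]
    rw [g.2 a.vec b.vec]

end Heisenberg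

end Symplectic

/-- `(G, G')` is a dual pair of subgroups of `Γ`: each is the full centralizer of the other. -/
def IsDualPair {Γ : Type*} [Group Γ] (G G' : Subgroup Γ) : Prop :=
  G' = Subgroup.centralizer (G : Set Γ) ∧ G = Subgroup.centralizer (G' : Set Γ)

section Representations

variable {F W V : Type*} [Field F] [AddCommGroup W] [Module F W] [AddCommGroup V] [Module ℂ V]
  {B : LinearMap.BilinForm F W}

/-- The representation `ρ` of `H(W)` has central character `χ`. -/
def HasCentralCharacter (ρ : Representation ℂ (Heisenberg B) V) (χ : AddChar F ℂ) : Prop :=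
  ∀ t : F, ρ ⟨0, t⟩ = χ t • (1 : Module.End ℂ V)

/-- `ω` is an oscillator representation attached to `ρ`: a representation of `Sp(W)` on the
space of `ρ` such that `ω(g) ρ(h) ω(g)⁻¹ = ρ(g(h))`. -/
def IsOscillatorRepresentation (ρ : Representation ℂ (Heisenberg B) V)
    (ω : Representation ℂ (Sp B) V) : Prop :=
  ∀ (g : Sp B) (h : Heisenberg B), ω g * ρ h * ω g⁻¹ = ρ (Heisenberg.aut g h)

/-- The action of a vector `(w, w')` of the signed double on operators:
`A ↦ ρ(w') A ρ(-w)`. -/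
def doubleAction (ρ : Representation ℂ (Heisenberg B) V) (u : W × W) (A : Module.End ℂ V) :
    Module.End ℂ V :=
  ρ ⟨u.2, 0⟩ * A * ρ ⟨-u.1, 0⟩

/-- The quantization of a subspace `L` of the signed double: the nonzero operators fixed by
`L`. For a Lagrangian `L` this is a line with zero removed, i.e. the operator `q(L)` with all
its nonzero multiples. -/
def quantization (ρ : Representation ℂ (Heisenberg B) V) (L : Submodule F (W × W)) :
    Set (Module.End ℂ V) :=
  {A | A ≠ 0 ∧ ∀ u ∈ L, doubleAction ρ u A = A}

/-- The oscillator semigroup `𝔖(2W)`: all operators `q(L)`, for `L` a Lagrangian subspace of the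
signed double. -/
def oscillatorSemigroup (ρ : Representation ℂ (Heisenberg B) V) : Set (Module.End ℂ V) :=
  {A | ∃ L : Submodule F (W × W), IsLagrangian (doubleForm B) L ∧ A ∈ quantization ρ L}

/-- `𝔖(2W)^G`: the elements of the oscillator semigroup which commute with `ω(g)`, `g ∈ G`. -/
def oscillatorSemigroupInvariants (ρ : Representation ℂ (Heisenberg B) V)
    (ω : Representation ℂ (Sp B) V) (G : Subgroup (Sp B)) : Set (Module.End ℂ V) :=
  {A | A ∈ oscillatorSemigroup ρ ∧ ∀ g ∈ G, ω g * A = A * ω g}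

/-- The commuting algebra of `ω(G)`: all operators which commute with `ω(g)`, `g ∈ G`. -/
def commutingAlgebra (ω : Representation ℂ (Sp B) V) (G : Subgroup (Sp B)) :
    Subalgebra ℂ (Module.End ℂ V) :=
  Subalgebra.centralizer ℂ ((fun g => ω g) '' (G : Set (Sp B)))

end Representations

end Oscillator

namespace Oscillator

section Witt

/-- In a ring where `2` is invertible, `2⁻¹` is central and self-adjoint. -/
theorem exists_half {R : Type*} [Ring R] [StarRing R] (h2 : IsUnit (2 : R)) :
    ∃ c : R, c + c = 1 ∧ (∀ x, c * x = x * c) ∧ star c = c := by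
  obtain ⟨c, hc⟩ := h2.exists_right_inv
  have hc1 : c + c = 1 := by rw [← two_mul, hc]
  have key : ∀ x y : R, x + x = y + y → x = y := by
    intro x y h
    have : c * (x + x) = c * (y + y) := by rw [h]
    have e : ∀ z : R, c * (z + z) = z := fun z => by
      rw [mul_add, ← add_mul, hc1, one_mul]
    rwa [e, e] at this
  refine ⟨c, hc1, fun x => key _ _ ?_, key _ _ ?_⟩
  · rw [← add_mul, ← mul_add, hc1, one_mul, mul_one]
  · rw [← star_add, hc1, star_one]

variable {R : Type*} [Ring R]

/-- Right multiplication by `y`, injective on a left ideal of a semisimple ring, has a right inverse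
there given by right multiplication. -/
theorem exists_right_mul_inverse [IsSemisimpleRing R] (M : Ideal R) (y : R)
    (h : ∀ x ∈ M, x * y = 0 → x = 0) : ∃ k : R, ∀ x ∈ M, x * y * k = x := by
  let f : M →ₗ[R] R := (LinearMap.toSpanSingleton R R y).comp M.subtype
  have hf : Function.Injective f := by
    rw [← LinearMap.ker_eq_bot, LinearMap.ker_eq_bot']
    intro x hx
    exact Subtype.ext (h x x.2 (by simpa [f] using hx))
  obtain ⟨g, hg⟩ := IsSemisimpleModule.extension_property f hf M.subtype
  refine ⟨g 1, fun x hx => ?_⟩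
  have := LinearMap.congr_fun hg ⟨x, hx⟩
  simp only [f, LinearMap.comp_apply, LinearMap.toSpanSingleton_apply, Submodule.subtype_apply,
    smul_eq_mul] at this
  rw [← smul_eq_mul, ← map_smul, smul_eq_mul, mul_one]
  exact this

/-- Complementary left ideals are generated by complementary idempotents. -/
theorem exists_isIdempotentElem_of_isCompl {M N : Ideal R} (h : IsCompl M N) :
    ∃ e : R, e ∈ M ∧ 1 - e ∈ N ∧ (∀ x ∈ M, x * e = x) ∧ (∀ x ∈ N, x * e = 0) := by
  have h1 : (1 : R) ∈ M ⊔ N := by rw [h.sup_eq_top]; trivial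
  obtain ⟨e, he, f, hf, hef⟩ := Submodule.mem_sup.1 h1
  have hfe : f = 1 - e := by rw [← hef]; simp
  have hd : ∀ z, z ∈ M → z ∈ N → z = 0 := fun z h1 h2 => by
    simpa using h.disjoint.le_bot ⟨h1, h2⟩
  subst hfe
  refine ⟨e, he, hf, fun x hx => ?_, fun x hx => ?_⟩
  · have : x - x * e = 0 := hd _ (M.sub_mem hx (M.mul_mem_left x he))
      (by rw [← mul_one_sub]; exact N.mul_mem_left x hf)
    rw [sub_eq_zero] at this
    exact this.symm
  · refine hd _ (M.mul_mem_left x he) ?_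
    have : x * e = x - x * (1 - e) := by rw [mul_one_sub, sub_sub_cancel]
    rw [this]
    exact N.sub_mem hx (N.mul_mem_left x hf)

theorem exists_relative_complement [IsSemisimpleRing R] {A B : Ideal R} (h : A ≤ B) :
    ∃ Z ≤ B, A ⊔ Z = B ∧ A ⊓ Z = ⊥ := by
  obtain ⟨C, hC⟩ := exists_isCompl A
  refine ⟨C ⊓ B, inf_le_right, ?_, ?_⟩
  · rw [← sup_inf_assoc_of_le C h, hC.sup_eq_top, top_inf_eq]
  · rw [← inf_assoc, hC.inf_eq_bot, bot_inf_eq]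

variable [StarRing R]

/-- The orthogonal of a left ideal for the hermitian form `x, y ↦ x y*`. -/
def leftPerp (D : Ideal R) : Ideal R where
  carrier := {p | ∀ q ∈ D, p * star q = 0}
  add_mem' := fun ha hb q hq => by rw [add_mul, ha q hq, hb q hq, add_zero]
  zero_mem' := fun q _ => zero_mul _
  smul_mem' := fun c x hx q hq => by rw [smul_eq_mul, mul_assoc, hx q hq, mul_zero]

theorem mul_star_eq_zero_comm {x y : R} (h : x * star y = 0) : y * star x = 0 := by
  rw [← star_star y, ← star_mul, h, star_zero]

/-- Witt extension from the orthogonal of a totally isotropic left ideal. -/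
theorem exists_unitary_extending_of_leftPerp [IsSemisimpleRing R] (h2 : IsUnit (2 : R))
    (D : Ideal R) (hD : D ≤ leftPerp D) (y : R)
    (hinj : ∀ x ∈ leftPerp D, x * y = 0 → x = 0)
    (hiso : ∀ x ∈ leftPerp D, ∀ x' ∈ leftPerp D, x * y * star (x' * y) = x * star x') :
    ∃ g : R, g * star g = 1 ∧ ∀ x ∈ leftPerp D, x * g = x * y := by
  obtain ⟨c, hc1, hcc, hcs⟩ := exists_half h2
  obtain ⟨k, hk⟩ := exists_right_mul_inverse _ y hinj
  obtain ⟨N, hN⟩ := exists_isCompl (leftPerp D)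
  obtain ⟨e₀, he₀, heN, hMe, hNe⟩ := exists_isIdempotentElem_of_isCompl hN
  set e := 1 - e₀ with he
  have hee : e * e = e := by
    have := hMe e₀ he₀
    rw [he, mul_sub, mul_one, sub_mul, one_mul, this]; simp
  obtain ⟨D', hD'⟩ := exists_isCompl D
  obtain ⟨q, hq, -, hDq, -⟩ := exists_isIdempotentElem_of_isCompl hD'
  obtain ⟨p, hp⟩ := exists_right_mul_inverse N (star q) (by
    intro x hx h0
    have : x ∈ leftPerp D := by
      intro z hz
      rw [← hDq z hz, star_mul, ← mul_assoc, h0, zero_mul]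
    simpa using hN.disjoint.le_bot ⟨this, hx⟩)
  have hpe : star p * q * star e = star e := by
    have := congrArg star (hp e heN)
    simpa [mul_assoc] using this
  set r := e * star k with hr
  have hry : ∀ m ∈ leftPerp D, r * star (m * y) = e * star m := by
    intro m hm
    have := congrArg star (hk m hm)
    rw [star_mul] at this
    rw [hr, mul_assoc, this]
  set H := r * star r - e * star e with hH
  have her : e * r = r := by rw [hr, ← mul_assoc, hee]
  have heH : e * H = H := by rw [hH, mul_sub, ← mul_assoc e r, her, ← mul_assoc e e, hee]
  have hHs : star H = H := by simp [hH]
  have hHe : H * star e = H := by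
    have := congrArg star heH
    rwa [star_mul, hHs] at this
  set δ' := -(c * H * star p * q) with hδ'
  have hδ'D : δ' ∈ D := by rw [hδ']; exact D.neg_mem (D.mul_mem_left _ hq)
  have hδ'e : δ' * star e = -(c * H) := by
    rw [hδ', neg_mul, mul_assoc, mul_assoc, ← mul_assoc (star p), hpe, mul_assoc, hHe]
  have heδ : e * δ' = δ' := by
    rw [hδ', mul_neg, ← mul_assoc, ← mul_assoc, ← mul_assoc, ← hcc e, mul_assoc c, heH]
  set δ := δ' * y with hδ
  have hδr : δ * star r = -(c * H) := by
    rw [hr, star_mul, star_star, ← mul_assoc, hδ, hk _ (hD hδ'D), hδ'e]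
  have hrδ : r * star δ = -(c * H) := by
    have := congrArg star hδr
    rw [star_mul δ, star_star, star_neg, star_mul c, hHs, hcs, ← hcc] at this
    exact this
  have hδδ : δ * star δ = 0 := by
    rw [hδ, hiso _ (hD hδ'D) _ (hD hδ'D)]
    exact hD hδ'D _ hδ'D
  have hδy : ∀ m ∈ leftPerp D, δ * star (m * y) = 0 := by
    intro m hm
    rw [hδ, hiso _ (hD hδ'D) _ hm]
    exact mul_star_eq_zero_comm (hm _ hδ'D)
  set s := r + δ with hs
  have hsy : ∀ m ∈ leftPerp D, s * star (m * y) = e * star m := by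
    intro m hm
    rw [hs, add_mul, hry m hm, hδy m hm, add_zero]
  have hss : s * star s = e * star e := by
    have : r * star r = H + e * star e := by rw [hH]; simp
    have hH2 : c * H + c * H = H := by rw [← add_mul, hc1, one_mul]
    rw [hs, star_add, add_mul, mul_add, mul_add, this, hδr, hrδ, hδδ]
    calc H + e * star e + -(c * H) + (-(c * H) + 0) = H - (c * H + c * H) + e * star e := by abel
      _ = _ := by rw [hH2]; simp
  have hes : e * s = s := by rw [hs, mul_add, her, hδ, ← mul_assoc, heδ]
  refine ⟨e₀ * y + s, ?_, fun x hx => ?_⟩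
  · have hys : e₀ * y * star s = e₀ * star e := by
      have := congrArg star (hsy e₀ he₀)
      simpa [mul_assoc] using this
    rw [star_add, add_mul, mul_add, mul_add, hiso _ he₀ _ he₀, hys, hsy _ he₀, hss, ← mul_add,
      ← mul_add, ← add_mul, ← star_add, he]
    simp
  · have hxe : x * e = 0 := by rw [he, mul_sub, mul_one, hMe x hx, sub_self]
    rw [mul_add, ← mul_assoc, hMe x hx, ← hes, ← mul_assoc, hxe, zero_mul, add_zero]

/-- One step of Witt's theorem, when `y` moves the left ideal `M` in an isotropic direction. -/
theorem exists_unitary_of_covBy_of_isotropic [IsSemisimpleRing R] [Finite R]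
    (h2 : IsUnit (2 : R)) {M' M : Ideal R} (hcov : M' ⋖ M) (y : R)
    (hfix : ∀ x ∈ M', x * y = x) (hinj : ∀ x ∈ M, x * y = 0 → x = 0)
    (hiso : ∀ x ∈ M, ∀ x' ∈ M, x * y * star (x' * y) = x * star x')
    (hK : ∀ x ∈ M, ∀ m ∈ M, x * y * star m = x * star m) :
    ∃ g : R, g * star g = 1 ∧ ∀ x ∈ M, x * g = x * y := by
  have hK' : ∀ x ∈ M, ∀ m ∈ M, x * star (m * y) = x * star m := fun x hx m hm => by
    have := congrArg star (hK m hm x hx)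
    simpa [mul_assoc] using this
  set D : Ideal R := Submodule.map (LinearMap.toSpanSingleton R R (y - 1)) M with hD
  set My : Ideal R := Submodule.map (LinearMap.toSpanSingleton R R y) M with hMy
  have hMD : M ≤ leftPerp D := by
    rintro p hp _ ⟨x, hx, rfl⟩
    simp only [LinearMap.toSpanSingleton_apply, smul_eq_mul]
    rw [mul_sub, mul_one, star_sub, mul_sub, hK' p hp x hx, sub_self]
  have hMyD : My ≤ leftPerp D := by
    rintro _ ⟨m, hm, rfl⟩ _ ⟨x, hx, rfl⟩
    simp only [LinearMap.toSpanSingleton_apply, smul_eq_mul]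
    rw [mul_sub, mul_one, star_sub, mul_sub, hiso m hm x hx, hK m hm x hx, sub_self]
  have hDD : D ≤ leftPerp D := by
    rintro _ ⟨m, hm, rfl⟩
    have h1 := hMyD ⟨m, hm, rfl⟩
    have h2 := hMD hm
    simp only [LinearMap.toSpanSingleton_apply, smul_eq_mul] at h1 ⊢
    rw [mul_sub, mul_one]
    exact Submodule.sub_mem _ h1 h2
  obtain ⟨Z, hZD, hMZ, hMZ0, hMyZ0⟩ : ∃ Z ≤ leftPerp D, M ⊔ Z = leftPerp D ∧ M ⊓ Z = ⊥ ∧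
      My ⊓ Z = ⊥ := by
    have hM'y : M' ≤ My := fun x hx => ⟨x, hcov.le hx, hfix x hx⟩
    rcases hcov.eq_or_eq (c := M ⊓ My) (le_inf hcov.le hM'y) inf_le_left with h | h
    · obtain ⟨Y, hY, hY1, hY2⟩ := exists_relative_complement (sup_le hMD hMyD)
      obtain ⟨N, hN, hN1, hN2⟩ := exists_relative_complement hcov.le
      have hY0 : ∀ z ∈ M ⊔ My, z ∈ Y → z = 0 := fun z h1 h2 => by
        have : z ∈ (M ⊔ My) ⊓ Y := ⟨h1, h2⟩
        simpa [hY2] using this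
      have hN0 : ∀ z ∈ M', z ∈ N → z = 0 := fun z h1 h2 => by
        have : z ∈ M' ⊓ N := ⟨h1, h2⟩
        simpa [hN2] using this
      have hMMy : ∀ z ∈ M, z ∈ My → z ∈ M' := fun z h1 h2 => by
        rw [← h]; exact ⟨h1, h2⟩
      have hyy : ∀ x ∈ M, x * y ∈ My := fun x hx => ⟨x, hx, rfl⟩
      have hy' : ∀ x ∈ N, x * y ∈ M → x = 0 := fun x hx hxy => by
        have h1 := hMMy _ hxy (hyy x (hN hx))
        have h2 := hfix _ h1
        have h3 : x * y - x = 0 := hinj _ (M.sub_mem hxy (hN hx)) (by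
          rw [sub_mul, h2, sub_self])
        rw [sub_eq_zero] at h3
        exact hN0 x (h3 ▸ h1) hx
      set P : Ideal R := Submodule.map (LinearMap.toSpanSingleton R R (1 + y)) N with hP
      have hPM : P ≤ M ⊔ My := by
        rintro _ ⟨x, hx, rfl⟩
        simp only [LinearMap.toSpanSingleton_apply, smul_eq_mul]
        rw [mul_add, mul_one]
        exact Submodule.add_mem_sup (hN hx) (hyy x (hN hx))
      have hN' : ∀ x ∈ N, x * y ∈ My := fun x hx => hyy x (hN hx)
      refine ⟨Y ⊔ P, sup_le hY (hPM.trans (sup_le hMD hMyD)), le_antisymm ?_ ?_, ?_, ?_⟩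
      · exact sup_le hMD (sup_le hY (hPM.trans (sup_le hMD hMyD)))
      · rw [← hY1]
        refine sup_le (sup_le le_sup_left ?_) (le_sup_left.trans le_sup_right)
        rintro _ ⟨x, hx, rfl⟩
        simp only [LinearMap.toSpanSingleton_apply, smul_eq_mul]
        rw [← hN1] at hx
        obtain ⟨x₁, hx₁, x₂, hx₂, rfl⟩ := Submodule.mem_sup.1 hx
        have e : (x₁ + x₂) * y = (x₁ - x₂) + x₂ * (1 + y) := by
          rw [add_mul, hfix _ hx₁, mul_add, mul_one]; abel
        rw [e]
        exact Submodule.add_mem_sup (M.sub_mem (hcov.le hx₁) (hN hx₂))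
          (Submodule.mem_sup_right ⟨x₂, hx₂, rfl⟩)
      · rw [eq_bot_iff]
        rintro z ⟨hz, hz'⟩
        obtain ⟨η, hη, _, ⟨x, hx, rfl⟩, rfl⟩ := Submodule.mem_sup.1 hz'
        simp only [LinearMap.toSpanSingleton_apply, smul_eq_mul] at hz ⊢
        have hη0 : η = 0 := by
          refine hY0 η ?_ hη
          have := Submodule.sub_mem _ (Submodule.mem_sup_left (T := My) hz) (hPM ⟨x, hx, rfl⟩)
          simpa using this
        subst hη0
        rw [zero_add, mul_add, mul_one] at hz
        have : x * y ∈ M := by simpa using M.sub_mem hz (hN hx)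
        simp [hy' x hx this]
      · rw [eq_bot_iff]
        rintro z ⟨hz, hz'⟩
        obtain ⟨η, hη, _, ⟨x, hx, rfl⟩, rfl⟩ := Submodule.mem_sup.1 hz'
        simp only [LinearMap.toSpanSingleton_apply, smul_eq_mul] at hz ⊢
        have hη0 : η = 0 := by
          refine hY0 η ?_ hη
          have := Submodule.sub_mem _ (Submodule.mem_sup_right (S := M) hz) (hPM ⟨x, hx, rfl⟩)
          simpa using this
        subst hη0
        rw [zero_add, mul_add, mul_one] at hz
        have h3 : x ∈ My := by simpa using My.sub_mem hz (hN' x hx)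
        simp [hN0 x (hMMy x (hN hx) h3) hx]
    · obtain ⟨Z, hZ, hZ1, hZ2⟩ := exists_relative_complement hMD
      have hle : M ≤ My := by rw [← h]; exact inf_le_right
      have heq : M = My := by
        refine SetLike.coe_injective (Set.eq_of_subset_of_ncard_le hle ?_ (Set.toFinite _))
        exact Set.ncard_image_le (Set.toFinite _)
      exact ⟨Z, hZ, hZ1, hZ2, by rw [← heq, hZ2]⟩
  have hcompl : ∃ N, IsCompl M N ∧ Z ≤ N := by
    obtain ⟨C, hC⟩ := exists_isCompl (M ⊔ Z)
    refine ⟨Z ⊔ C, ⟨?_, ?_⟩, le_sup_left⟩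
    · exact Disjoint.disjoint_sup_right_of_disjoint_sup_left (disjoint_iff.2 hMZ0) hC.disjoint
    · rw [codisjoint_iff, ← sup_assoc, hC.sup_eq_top]
  obtain ⟨N, hN, hZN⟩ := hcompl
  obtain ⟨e, he, -, hMe, hNe⟩ := exists_isIdempotentElem_of_isCompl hN
  set w := e * y + (1 - e) with hw
  have hmw : ∀ m ∈ M, m * w = m * y := fun m hm => by
    rw [hw, mul_add, ← mul_assoc, mul_sub, mul_one, hMe m hm, sub_self, add_zero]
  have hzw : ∀ z ∈ Z, z * w = z := fun z hz => by
    rw [hw, mul_add, ← mul_assoc, mul_sub, mul_one, hNe z (hZN hz)]; simp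
  have hmz : ∀ m ∈ M, ∀ z ∈ Z, z * star (m * y) = z * star m := fun m hm z hz => by
    have := hZD hz (m * (y - 1)) ⟨m, hm, rfl⟩
    rwa [mul_sub, mul_one, star_sub, mul_sub, sub_eq_zero] at this
  have hmz' : ∀ m ∈ M, ∀ z ∈ Z, m * y * star z = m * star z := fun m hm z hz => by
    have := congrArg star (hmz m hm z hz)
    simpa [mul_assoc] using this
  obtain ⟨g, hg, hgx⟩ := exists_unitary_extending_of_leftPerp h2 D hDD w (by
    intro x hx h0
    rw [← hMZ] at hx
    obtain ⟨m, hm, z, hz, rfl⟩ := Submodule.mem_sup.1 hx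
    rw [add_mul, hmw m hm, hzw z hz] at h0
    have h1 : z ∈ My ⊓ Z := by
      refine ⟨?_, hz⟩
      rw [← neg_eq_iff_add_eq_zero] at h0
      rw [← h0]
      exact My.neg_mem ⟨m, hm, rfl⟩
    rw [hMyZ0, Submodule.mem_bot] at h1
    subst h1
    rw [add_zero] at h0 ⊢
    exact hinj m hm h0) (by
    intro x hx x' hx'
    rw [← hMZ] at hx hx'
    obtain ⟨m, hm, z, hz, rfl⟩ := Submodule.mem_sup.1 hx
    obtain ⟨m', hm', z', hz', rfl⟩ := Submodule.mem_sup.1 hx'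
    rw [add_mul m z w, add_mul m' z' w, hmw m hm, hmw m' hm', hzw z hz, hzw z' hz', star_add,
      star_add, add_mul, add_mul, mul_add, mul_add, mul_add, mul_add, hiso m hm m' hm',
      hmz m' hm' z hz, hmz' m hm z' hz'])
  exact ⟨g, hg, fun x hx => by rw [hgx x (hMD hx), hmw x hx]⟩

/-- One step of Witt's theorem: an isometry of a left ideal fixing a maximal subideal. -/
theorem exists_unitary_of_covBy [IsSemisimpleRing R] [Finite R]
    (h2 : IsUnit (2 : R)) {M' M : Ideal R} (hcov : M' ⋖ M) (y : R)
    (hfix : ∀ x ∈ M', x * y = x) (hinj : ∀ x ∈ M, x * y = 0 → x = 0)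
    (hiso : ∀ x ∈ M, ∀ x' ∈ M, x * y * star (x' * y) = x * star x') :
    ∃ g : R, g * star g = 1 ∧ ∀ x ∈ M, x * g = x * y := by
  by_cases hK : ∀ x ∈ M, ∀ m ∈ M, x * y * star m = x * star m
  · exact exists_unitary_of_covBy_of_isotropic h2 hcov y hfix hinj hiso hK
  set d := y - 1 with hd
  have hyd : ∀ x, x * y = x + x * d := fun x => by rw [hd, mul_sub, mul_one]; abel
  obtain ⟨M₁, hM₁, hM₁1, hM₁2⟩ := exists_relative_complement hcov.le
  obtain ⟨f, hf, hM₁f, hM'f⟩ : ∃ f ∈ M₁, (∀ x ∈ M₁, x * f = x) ∧ ∀ x ∈ M', x * f = 0 := by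
    obtain ⟨C, hC⟩ := exists_isCompl (M₁ ⊔ M')
    have : IsCompl M₁ (M' ⊔ C) := by
      refine ⟨Disjoint.disjoint_sup_right_of_disjoint_sup_left
        (disjoint_iff.2 (by rw [inf_comm, hM₁2])) hC.disjoint, ?_⟩
      rw [codisjoint_iff, ← sup_assoc, hC.sup_eq_top]
    obtain ⟨f, hf, -, h1, h2⟩ := exists_isIdempotentElem_of_isCompl this
    exact ⟨f, hf, h1, fun x hx => h2 x (Submodule.mem_sup_left hx)⟩
  have hff : f * f = f := hM₁f f hf
  have hfM : f ∈ M := hM₁ hf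
  have hsff : star f * star f = star f := by rw [← star_mul, hff]
  have hdec : ∀ m ∈ M, ∃ m' ∈ M', m = m' + m * f := by
    intro m hm
    rw [← hM₁1] at hm
    obtain ⟨a, ha, b, hb, rfl⟩ := Submodule.mem_sup.1 hm
    exact ⟨a, ha, by rw [add_mul, hM'f a ha, hM₁f b hb, zero_add]⟩
  have hd0 : ∀ m ∈ M', m * d = 0 := fun m hm => by
    rw [hd, mul_sub, mul_one, hfix m hm, sub_self]
  have hperp : ∀ x ∈ M, ∀ m ∈ M', x * d * star m = 0 := by
    intro x hx m hm
    have := hiso x hx m (hcov.le hm)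
    rw [hfix m hm, hyd, add_mul] at this
    simpa using this
  have hperp' : ∀ x ∈ M, ∀ m ∈ M', m * star (x * d) = 0 := fun x hx m hm =>
    mul_star_eq_zero_comm (hperp x hx m hm)
  set c := f * d * star f with hc
  set u := f * d with hu
  have hid : c + star c + u * star u = 0 := by
    have h1 := hiso f hfM f hfM
    rw [hyd, ← hu, star_add, add_mul, mul_add, mul_add] at h1
    have h3 : star c = f * star u := by rw [hc, star_mul, star_star]
    rw [h3, hc]
    have : f * star f + (f * star u + (u * star f + u * star u)) = f * star f := by
      rw [← add_assoc, h1]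
    rw [add_eq_left] at this
    rw [← this]; abel
  have hcstar : star c = f * star u := by rw [hc, star_mul, star_star]
  have inv_of_inj : ∀ z, z * star f = z → (∀ x ∈ M₁, x * z = 0 → x = 0) →
      f * z = z → ∃ k, star f * k = k ∧ k * f = k ∧ z * k = f := by
    intro z hz hinj hfz
    obtain ⟨k, hk⟩ := exists_right_mul_inverse M₁ z hinj
    refine ⟨star f * k * f, by rw [← mul_assoc, ← mul_assoc, hsff], by rw [mul_assoc, hff], ?_⟩
    rw [← mul_assoc, ← mul_assoc, hz]
    have := hk f hf
    rw [hfz] at this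
    rw [this, hff]
  have hcf : c * star f = c := by rw [hc, mul_assoc, hsff]
  have hfc : f * c = c := by rw [hc, hu, ← mul_assoc, ← mul_assoc, hff]
  have hfu : f * u = u := by rw [hu, ← mul_assoc, hff]
  have hcsf : star c * star f = star c := by rw [← star_mul, hfc]
  have hfcs : f * star c = star c := by
    have := congrArg star hcf
    rwa [star_mul, star_star] at this
  have hext : ∀ x ∈ M₁, x * c = 0 → ∀ m ∈ M, x * d * star m = 0 := by
    intro x hx h0 m hm
    obtain ⟨m', hm', he⟩ := hdec m hm
    rw [he, star_add, mul_add, hperp x (hM₁ hx) m' hm', star_mul, zero_add]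
    have : x * d * star f = 0 := by
      rw [← hM₁f x hx, mul_assoc x f d, mul_assoc x, ← hu]; exact h0
    rw [← mul_assoc, this, zero_mul]
  have hext' : ∀ x ∈ M₁, x * star c = 0 → ∀ m ∈ M, x * star (m * d) = 0 := by
    intro x hx h0 m hm
    obtain ⟨m', hm', he⟩ := hdec m hm
    rw [he, add_mul, hd0 m' hm', zero_add, mul_assoc m f d, ← hu, star_mul, ← mul_assoc,
      ← hM₁f x hx, mul_assoc x, ← hcstar, h0, zero_mul]
  have hzero : ∀ K : Ideal R, M' ≤ K → K ≤ M → K ≠ M → ∀ x ∈ M₁, x ∈ K → x = 0 := by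
    intro K h1 h2 h3 x hx hxK
    have hKM : K = M' := (hcov.eq_or_eq h1 h2).resolve_right h3
    have : x ∈ M' ⊓ M₁ := ⟨hKM ▸ hxK, hx⟩
    simpa [hM₁2] using this
  have hcinj : ∀ x ∈ M₁, x * c = 0 → x = 0 := by
    let K : Ideal R :=
      { carrier := {x | x ∈ M ∧ ∀ m ∈ M, x * d * star m = 0}
        add_mem' := fun {a b} ha hb => ⟨M.add_mem ha.1 hb.1, fun m hm => by
          rw [add_mul, add_mul, ha.2 m hm, hb.2 m hm, add_zero]⟩
        zero_mem' := ⟨M.zero_mem, fun m _ => by simp⟩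
        smul_mem' := fun a x hx => ⟨M.mul_mem_left a hx.1, fun m hm => by
          rw [smul_eq_mul, mul_assoc, mul_assoc, ← mul_assoc x, hx.2 m hm, mul_zero]⟩ }
    intro x hx h0
    refine hzero K (fun m hm => ⟨hcov.le hm, fun m' _ => by rw [hd0 m hm, zero_mul]⟩)
      (fun m hm => hm.1) (fun hKM => hK fun x hx m hm => ?_) x hx ⟨hM₁ hx, hext x hx h0⟩
    rw [← hKM] at hx
    rw [hyd, add_mul, hx.2 m hm, add_zero]
  have hcsinj : ∀ x ∈ M₁, x * star c = 0 → x = 0 := by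
    let K : Ideal R :=
      { carrier := {x | x ∈ M ∧ ∀ m ∈ M, x * star (m * d) = 0}
        add_mem' := fun {a b} ha hb => ⟨M.add_mem ha.1 hb.1, fun m hm => by
          rw [add_mul, ha.2 m hm, hb.2 m hm, add_zero]⟩
        zero_mem' := ⟨M.zero_mem, fun m _ => by simp⟩
        smul_mem' := fun a x hx => ⟨M.mul_mem_left a hx.1, fun m hm => by
          rw [smul_eq_mul, mul_assoc, hx.2 m hm, mul_zero]⟩ }
    intro x hx h0
    refine hzero K (fun m hm => ⟨hcov.le hm, fun m' hm' => hperp' m' hm' m hm⟩)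
      (fun m hm => hm.1) (fun hKM => hK fun x hx m hm => ?_) x hx ⟨hM₁ hx, hext' x hx h0⟩
    rw [← hKM] at hm
    rw [hyd, add_mul, mul_star_eq_zero_comm (hm.2 x hx), add_zero]
  obtain ⟨k₁, hk1, hk2, hk3⟩ := inv_of_inj c hcf hcinj hfc
  obtain ⟨k, hk4, hk5, hk6⟩ := inv_of_inj (star c) hcsf hcsinj hfcs
  have hk7 : star k * c = star f := by
    have := congrArg star hk6
    rwa [star_mul, star_star] at this
  have hk8 : star k = k₁ := by
    have h1 : star k * f = star k := by
      have := congrArg star hk4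
      rwa [star_mul, star_star] at this
    calc star k = star k * (c * k₁) := by rw [hk3, h1]
      _ = k₁ := by rw [← mul_assoc, hk7, hk1]
  have hk9 : k * star c = star f := by
    have := congrArg star hk3
    rwa [star_mul, ← hk8, star_star] at this
  have hu' : u * star u = -(c + star c) := by
    rw [eq_neg_iff_add_eq_zero, ← hid]; abel
  refine ⟨1 + star u * k * u, ?_, fun x hx => ?_⟩
  · have e1 : star (1 + star u * k * u) = 1 + star u * star k * u := by
      simp [mul_assoc]
    have hfk : star f * star k = star k := by rw [← star_mul, hk5]
    have e2 : k * (u * star u) * star k = -(k + star k) := by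
      rw [hu', mul_neg, neg_mul, mul_add, add_mul, hk9, hfk, mul_assoc k c, hk8, hk3, hk5]
    rw [e1, add_mul, one_mul, mul_add, mul_one]
    have : star u * k * u * (star u * star k * u) = star u * (k * (u * star u) * star k) * u := by
      simp only [mul_assoc]
    rw [this, e2, mul_neg, neg_mul, mul_add, add_mul]
    abel
  · obtain ⟨m', hm', he⟩ := hdec x hx
    have hfg : f * (1 + star u * k * u) = f * y := by
      rw [hyd, mul_add, mul_one, mul_assoc (star u), ← mul_assoc f, ← hcstar, ← mul_assoc, hk6, hfu]
    have hmg : m' * (1 + star u * k * u) = m' * y := by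
      rw [hyd, hd0 m' hm', mul_add, mul_one, mul_assoc (star u), ← mul_assoc m',
        hperp' f hfM m' hm', zero_mul]
    rw [he, add_mul, add_mul, hmg, mul_assoc x, hfg, ← mul_assoc]

/-- Witt's theorem for the hermitian form `x, y ↦ x y*` of a finite semisimple ring with
involution in which `2` is invertible: an isometric embedding of a left ideal is given by right
multiplication by a unitary element. -/
theorem witt_extension [IsSemisimpleRing R] [Finite R] (h2 : IsUnit (2 : R)) (M : Ideal R) :
    ∀ y : R, (∀ x ∈ M, x * y = 0 → x = 0) →
      (∀ x ∈ M, ∀ x' ∈ M, x * y * star (x' * y) = x * star x') →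
      ∃ g : R, g * star g = 1 ∧ ∀ x ∈ M, x * g = x * y := by
  induction M using WellFoundedLT.induction with
  | ind M ih =>
    intro y hinj hiso
    rcases eq_or_ne M ⊥ with rfl | hM
    · exact ⟨1, by simp, fun x hx => by simp [(Submodule.mem_bot R).1 hx]⟩
    obtain ⟨M', -, hcov⟩ := exists_le_covBy_of_lt (bot_lt_iff_ne_bot.2 hM)
    obtain ⟨g', hg', hgx⟩ := ih M' hcov.lt y (fun x hx => hinj x (hcov.le hx))
      (fun x hx x' hx' => hiso x (hcov.le hx) x' (hcov.le hx'))
    have hg'' : star g' * g' = 1 := mul_eq_one_comm.1 hg'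
    obtain ⟨g, hg, hgM⟩ := exists_unitary_of_covBy h2 hcov (y * star g')
      (fun x hx => by rw [← mul_assoc, ← hgx x hx, mul_assoc, hg', mul_one])
      (fun x hx h0 => hinj x hx (by
        rw [← mul_one (x * y), ← hg'', ← mul_assoc, mul_assoc x y, h0, zero_mul]))
      (fun x hx x' hx' => by
        rw [← hiso x hx x' hx']
        simp only [star_mul, star_star, mul_assoc]
        rw [← mul_assoc (star g') g', hg'', one_mul])
    refine ⟨g * g', ?_, fun x hx => ?_⟩
    · rw [star_mul, mul_assoc, ← mul_assoc g', hg', one_mul, hg]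
    · rw [← mul_assoc, hgM x hx, mul_assoc, mul_assoc, hg'', mul_one]

end Witt

section UnitaryLifting

variable {R : Type*} [Ring R]

theorem exists_pow_isIdempotentElem {M : Type*} [Monoid M] [Finite M] (x : M) :
    ∃ n, n ≠ 0 ∧ IsIdempotentElem (x ^ n) := by
  obtain ⟨m, m', hne, h⟩ := Finite.exists_ne_map_eq_of_infinite (fun n : ℕ => x ^ n)
  wlog hlt : m < m' generalizing m m'
  · exact this m' m hne.symm h.symm (lt_of_le_of_ne (not_lt.1 hlt) hne.symm)
  obtain ⟨d, rfl⟩ := Nat.exists_eq_add_of_lt hlt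
  have h1 : ∀ k t, m ≤ k → x ^ (k + (d + 1) * t) = x ^ k := by
    intro k t hk
    obtain ⟨l, rfl⟩ := Nat.exists_eq_add_of_le hk
    induction t with
    | zero => simp
    | succ t ih =>
      have : m + l + (d + 1) * (t + 1) = (m + d + 1) + (l + (d + 1) * t) := by ring
      rw [this, pow_add]
      replace h : x ^ m = x ^ (m + d + 1) := h
      rw [← h, ← pow_add, ← add_assoc, ih]
  refine ⟨(d + 1) * (m + 1), by positivity, ?_⟩
  rw [IsIdempotentElem, ← pow_add]
  exact h1 _ _ (by nlinarith)

theorem isUnit_one_add_of_mem_jacobson [Finite R] {x : R} (hx : x ∈ Ring.jacobson R) :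
    IsUnit (1 + x) := by
  rw [← Ideal.jacobson_bot, Ideal.mem_jacobson_iff] at hx
  obtain ⟨z, hz⟩ := hx 1
  rw [Submodule.mem_bot, mul_one, sub_eq_zero] at hz
  have h : z * (1 + x) = 1 := by rw [mul_add, mul_one, add_comm, hz]
  exact IsUnit.of_mul_eq_one z (mul_eq_one_comm.1 h)

theorem star_mem_jacobson [StarRing R] [Finite R] {x : R} (hx : x ∈ Ring.jacobson R) :
    star x ∈ Ring.jacobson R := by
  rw [← Ideal.jacobson_bot, Ideal.mem_jacobson_iff]
  intro y
  have h : IsUnit (1 + x * star y) :=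
    isUnit_one_add_of_mem_jacobson (Ideal.mul_mem_right _ _ hx)
  obtain ⟨z, hz⟩ := h.star.exists_left_inv
  refine ⟨z, ?_⟩
  rw [Submodule.mem_bot, sub_eq_zero, ← hz]
  simp [mul_add, mul_assoc, add_comm]

/-- The involution of the quotient of a star ring by a star-stable two-sided ideal. -/
noncomputable abbrev quotientStarRing [StarRing R] (J : Ideal R) [J.IsTwoSided]
    (h : ∀ x ∈ J, star x ∈ J) : StarRing (R ⧸ J) where
  star := QuotientAddGroup.map J.toAddSubgroup J.toAddSubgroup
    (starAddEquiv : R ≃+ R).toAddMonoidHom h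
  star_involutive := by
    rintro ⟨x⟩
    exact congrArg (Ideal.Quotient.mk J) (star_star x)
  star_mul := by
    rintro ⟨x⟩ ⟨y⟩
    exact congrArg (Ideal.Quotient.mk J) (star_mul x y)
  star_add := by
    rintro ⟨x⟩ ⟨y⟩
    exact congrArg (Ideal.Quotient.mk J) (star_add x y)

variable [StarRing R] [Finite R]

/-- Witt's theorem modulo the Jacobson radical. -/
theorem exists_unitary_mod_jacobson (h2 : IsUnit (2 : R)) (I : Ideal R) {h h' a : R}
    (hgen : 1 - h' * h ∈ I) (ha : a ∈ I) (hh : star h * h = 1 + a + star a) :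
    ∃ g, g - h ∈ I ∧ star g * g - 1 ∈ Ring.jacobson R := by
  set J := Ring.jacobson R with hJ
  let _ : StarRing (R ⧸ J) := quotientStarRing J fun x hx => star_mem_jacobson hx
  have : IsSemisimpleRing (R ⧸ J) := IsSemiprimaryRing.isSemisimpleRing
  have : Finite (R ⧸ J) := Quotient.finite _
  set π := Ideal.Quotient.mk J with hπ
  have hstar : ∀ x, π (star x) = star (π x) := fun x => rfl
  have hsurj : Function.Surjective π := Ideal.Quotient.mk_surjective
  let M : Ideal (R ⧸ J) :=
    { carrier := {x | ∀ i ∈ I, x * π (star i) = 0}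
      add_mem' := fun ha hb i hi => by rw [add_mul, ha i hi, hb i hi, add_zero]
      zero_mem' := fun i _ => zero_mul _
      smul_mem' := fun c x hx i hi => by rw [smul_eq_mul, mul_assoc, hx i hi, mul_zero] }
  have h2' : IsUnit (2 : R ⧸ J) := by
    have := h2.map π
    rwa [map_ofNat] at this
  obtain ⟨g, hg, hgM⟩ := witt_extension h2' M (π (star h))
    (by
      intro x hx h0
      have h1 := hx _ hgen
      rw [star_sub, star_mul, star_one, map_sub, map_one, map_mul, mul_sub, ← mul_assoc, h0,
        zero_mul, mul_one, sub_zero] at h1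
      exact h1)
    (by
      intro x hx x' hx'
      have h1 : π a * star x' = 0 := by
        have := congrArg star (hx' a ha)
        rwa [star_mul, ← hstar, star_star, star_zero] at this
      have h3 : π (star h) * π h = 1 + π a + π (star a) := by
        rw [← map_mul, hh]; simp
      rw [star_mul, ← hstar, star_star, mul_assoc, ← mul_assoc _ (π h), h3, add_mul, add_mul, h1,
        one_mul, mul_add, mul_add, ← mul_assoc x (π (star a)), hx a ha]
      simp)
  obtain ⟨N, hN⟩ := exists_isCompl (I.map π)
  obtain ⟨e, he, -, hIe, -⟩ := exists_isIdempotentElem_of_isCompl hN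
  have heM : 1 - star e ∈ M := by
    intro i hi
    have h1 := congrArg star (hIe (π i) (Ideal.mem_map_of_mem π hi))
    rw [star_mul] at h1
    rw [hstar, sub_mul, one_mul, h1, sub_self]
  have h3 := congrArg star (hgM _ heM)
  rw [star_mul, star_mul, ← hstar, star_star, star_sub, star_one, star_star] at h3
  have h4 : star g - π h ∈ I.map π := by
    have : star g - π h = (star g - π h) * e := by
      rw [← sub_eq_zero, ← mul_one_sub, sub_mul, h3, sub_self]
    rw [this]
    exact Ideal.mul_mem_left _ _ he
  obtain ⟨i, hi, hi'⟩ := (Ideal.mem_map_iff_of_surjective π hsurj).1 h4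
  refine ⟨h + i, by simpa using hi, ?_⟩
  rw [← Ideal.Quotient.eq_zero_iff_mem]
  change π _ = 0
  have h5 : π (h + i) = star g := by rw [map_add, hi']; abel
  rw [map_sub, map_mul, hstar, h5, star_star, hg, map_one, sub_self]

/-- A hermitian element of the radical lying in `I + I*` comes from `I ∩ J`. -/
theorem exists_mem_inf_jacobson (h2 : IsUnit (2 : R)) (I : Ideal R) {a : R} (ha : a ∈ I)
    (hJ : a + star a ∈ Ring.jacobson R) :
    ∃ a' ∈ I, a' ∈ Ring.jacobson R ∧ a + star a = a' + star a' := by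
  obtain ⟨c, hc1, hcc, hcs⟩ := exists_half h2
  set J := Ring.jacobson R
  have : IsSemisimpleRing (R ⧸ J) := IsSemiprimaryRing.isSemisimpleRing
  set π := Ideal.Quotient.mk J with hπ
  have hsurj : Function.Surjective π := Ideal.Quotient.mk_surjective
  obtain ⟨N, hN⟩ := exists_isCompl (I.map π)
  obtain ⟨e', he', -, hIe, -⟩ := exists_isIdempotentElem_of_isCompl hN
  obtain ⟨z, hz, rfl⟩ := (Ideal.mem_map_iff_of_surjective π hsurj).1 he'
  obtain ⟨n, hn, he⟩ := exists_pow_isIdempotentElem z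
  set e := z ^ n with hez
  have heI : e ∈ I := by
    obtain ⟨m, rfl⟩ := Nat.exists_eq_succ_of_ne_zero hn
    rw [hez, pow_succ]
    exact I.mul_mem_left _ hz
  have hπe : π e = π z := by
    have h1 : IsIdempotentElem (π z) := hIe _ he'
    rw [hez, map_pow, h1.pow_eq hn]
  have hn' : a - a * e ∈ J := by
    rw [← Ideal.Quotient.eq_zero_iff_mem]
    change π _ = 0
    rw [map_sub, map_mul, hπe, hIe _ (Ideal.mem_map_of_mem π ha), sub_self]
  set b := a * e with hb
  have hbe : b * e = b := by rw [hb, mul_assoc, he.eq]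
  have hsb : star e * star b = star b := by rw [← star_mul, hbe]
  set x := b + star b with hx
  have hxJ : x ∈ J := by
    have h1 : x = (a + star a) - ((a - b) + star (a - b)) := by
      rw [hx, star_sub]; abel
    rw [h1]
    exact J.sub_mem hJ (J.add_mem hn' (star_mem_jacobson hn'))
  have hxs : star x = x := by rw [hx, star_add, star_star, add_comm]
  have hfxf : (1 - star e) * x * (1 - e) = 0 := by
    rw [hx, mul_add, sub_mul _ _ (star b), hsb, one_mul, sub_self, add_zero, mul_assoc, mul_sub,
      hbe, mul_one, sub_self, mul_zero]
  set a' := c * (star e * x * e) + (1 - star e) * x * e with ha'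
  have hsum : a' + star a' = x := by
    have h1 : star a' = c * (star e * x * e) + star e * x * (1 - e) := by
      rw [ha']
      simp only [star_add, star_mul, star_star, star_sub, star_one, hxs, hcs, mul_assoc]
      rw [hcc]
      simp only [mul_assoc]
    have h3 : a' + star a' = (c + c) * (star e * x * e) + (1 - star e) * x * e
        + star e * x * (1 - e) := by
      rw [h1, ha', add_mul]; abel
    rw [h3, hc1, one_mul]
    have h4 : x = star e * x * e + (1 - star e) * x * e + star e * x * (1 - e) +
      (1 - star e) * x * (1 - e) := by noncomm_ring
    rw [hfxf, add_zero] at h4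
    exact h4.symm
  refine ⟨a' + (a - b), I.add_mem (I.add_mem ?_ ?_) (I.sub_mem ha (I.mul_mem_left _ heI)),
    J.add_mem (J.add_mem ?_ ?_) hn', ?_⟩
  · rw [← mul_assoc]; exact I.mul_mem_left _ heI
  · exact I.mul_mem_left _ heI
  · exact J.mul_mem_left _ (J.mul_mem_right _ (J.mul_mem_left _ hxJ))
  · exact J.mul_mem_right _ (J.mul_mem_left _ hxJ)
  · rw [star_add, add_add_add_comm, hsum, hx, star_sub]; abel

/-- Let `R` be a finite ring with involution in which `2` is invertible and `I` a left ideal. If `h`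
generates `R` modulo `I` and is unitary modulo `I + I*`, then `h` is congruent modulo `I` to a
unitary element. -/
theorem exists_unitary_sub_mem (h2 : IsUnit (2 : R)) (I : Ideal R) {h h' a : R}
    (hgen : 1 - h' * h ∈ I) (ha : a ∈ I) (hh : star h * h = 1 + a + star a) :
    ∃ g, g - h ∈ I ∧ star g * g = 1 := by
  obtain ⟨c, hc1, hcc, hcs⟩ := exists_half h2
  set J := Ring.jacobson R with hJ
  have key : ∀ m : ℕ, ∃ g, g - h ∈ I ∧ ∃ b ∈ I, star b ∈ J ^ (m + 1) ∧
      star g * g = 1 + b + star b := by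
    intro m
    induction m with
    | zero =>
      obtain ⟨g, hg, hgJ⟩ := exists_unitary_mod_jacobson h2 I hgen ha hh
      have hb : a + star h * (g - h) + c * (star (g - h) * (g - h)) ∈ I :=
        I.add_mem (I.add_mem ha (I.mul_mem_left _ hg)) (I.mul_mem_left _ (I.mul_mem_left _ hg))
      set b := a + star h * (g - h) + c * (star (g - h) * (g - h)) with hbdef
      have hgb : star g * g = 1 + b + star b := by
        set i := g - h with hi
        have hgi : g = h + i := by rw [hi]; abel
        have h1 : star b = star a + star i * h + c * (star i * i) := by
          rw [hbdef]
          simp only [star_add, star_mul, star_star, hcs]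
          rw [← hcc]
        have h3 : star i * i = c * (star i * i) + c * (star i * i) := by
          rw [← add_mul, hc1, one_mul]
        rw [h1, hbdef, hgi, star_add, add_mul, mul_add, mul_add, hh]
        calc _ = 1 + a + star a + star h * i + star i * h + star i * i := by abel
          _ = 1 + a + star a + star h * i + star i * h +
              (c * (star i * i) + c * (star i * i)) := by rw [← h3]
          _ = _ := by abel
      obtain ⟨b', hb'I, hb'J, hbb⟩ := exists_mem_inf_jacobson h2 I hb (by
        have : b + star b = star g * g - 1 := by rw [hgb]; abel
        rw [this]; exact hgJ)
      exact ⟨g, hg, b', hb'I, by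
        rw [zero_add, Submodule.pow_one]; exact star_mem_jacobson hb'J, by rw [hgb, add_assoc, hbb, add_assoc]⟩
    | succ m ih =>
      obtain ⟨g, hg, b, hbI, hbJ, hgb⟩ := ih
      have hbJ1 : b ∈ J := by
        have : J ^ (m + 1) ≤ J := by
          rw [Submodule.pow_succ]; exact Ideal.mul_le_right
        simpa using star_mem_jacobson (this hbJ)
      set s := star g * g with hs
      have hss : star s = s := by rw [hs, star_mul, star_star]
      obtain ⟨u, hu⟩ := isUnit_one_add_of_mem_jacobson
        (J.add_mem hbJ1 (star_mem_jacobson hbJ1))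
      rw [← add_assoc, ← hgb] at hu
      set t : R := ↑u⁻¹ with ht
      have hst : s * t = 1 := by rw [← hu]; simp [ht]
      have hts : t * s = 1 := by rw [← hu]; simp [ht]
      have htt : star t = t := by
        have h1 := congrArg star hst
        rw [star_mul, hss, star_one] at h1
        calc star t = star t * (s * t) := by rw [hst, mul_one]
          _ = t := by rw [← mul_assoc, h1, one_mul]
      refine ⟨g - g * t * b, ?_, c * (star b * t * b), ?_, ?_, ?_⟩
      · rw [sub_right_comm]
        exact I.sub_mem hg (I.mul_mem_left _ hbI)
      · exact I.mul_mem_left _ (I.mul_mem_left _ hbI)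
      · rw [star_mul, hcs, ← hcc, star_mul, star_mul, star_star, htt, Submodule.pow_succ]
        exact Ideal.mul_mem_left _ _ (Ideal.mul_mem_mul hbJ (J.mul_mem_left _ hbJ1))
      · have h1 : star (c * (star b * t * b)) = c * (star b * t * b) := by
          simp only [star_mul, star_star, htt, hcs]
          rw [← hcc, mul_assoc]
        have h3 : star b * t * b = c * (star b * t * b) + c * (star b * t * b) := by
          rw [← add_mul, hc1, one_mul]
        have h4 : star (g - g * t * b) * (g - g * t * b)
            = s - (s * t) * b - star b * (t * s) + star b * t * (s * t) * b := by
          rw [hs]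
          simp only [star_sub, star_mul, htt]
          noncomm_ring
        rw [h4, hst, hts, h1, one_mul, mul_one, mul_one, hgb, add_assoc 1 (c * _), ← h3]
        abel
  obtain ⟨n, hn⟩ : IsNilpotent J := IsSemiprimaryRing.isNilpotent
  obtain ⟨g, hg, b, -, hb, hgb⟩ := key n
  have hb0 : b = 0 := by
    have : J ^ (n + 1) = ⊥ := by rw [Submodule.pow_succ, hn]; exact Submodule.bot_mul J
    rw [this, Submodule.mem_bot] at hb
    rw [← star_star b, hb, star_zero]
  exact ⟨g, hg, by rw [hgb, hb0]; simp⟩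

end UnitaryLifting

section Lagrangian

variable {F W : Type*} [Field F] [AddCommGroup W] [Module F W]

theorem isLagrangian_iff_orthogonal_eq {B : LinearMap.BilinForm F W} (hB : B.IsAlt)
    {L : Submodule F W} : IsLagrangian B L ↔ B.orthogonal L = L := by
  constructor
  · intro h
    refine le_antisymm (fun x hx => ?_) fun x hx => fun y hy => h.1 y hy x hx
    have hx1 : ∀ y ∈ L, B y x = 0 := fun y hy => hx y hy
    have hx2 : ∀ y ∈ L, B x y = 0 := fun y hy => by rw [← hB.neg_eq, hx1 y hy, neg_zero]
    have : ∀ y ∈ L ⊔ Submodule.span F {x}, ∀ z ∈ L ⊔ Submodule.span F {x}, B y z = 0 := by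
      intro y hy z hz
      obtain ⟨l, hl, u, hu, rfl⟩ := Submodule.mem_sup.1 hy
      obtain ⟨l', hl', v, hv, rfl⟩ := Submodule.mem_sup.1 hz
      obtain ⟨a, rfl⟩ := Submodule.mem_span_singleton.1 hu
      obtain ⟨b, rfl⟩ := Submodule.mem_span_singleton.1 hv
      simp [h.1 l hl l' hl', hx1 l hl, hx2 l' hl', hB.self_eq_zero x]
    exact h.2 this le_sup_left (Submodule.mem_sup_right (Submodule.mem_span_singleton_self x))
  · intro h
    refine ⟨fun x hx y hy => ?_, fun M hM hLM x hx => ?_⟩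
    · rw [← h] at hy
      exact hy x hx
    · rw [← h]
      exact fun y hy => hM y (hLM hy) x hx

/-- Symplectic reduction of a Lagrangian by an isotropic subspace. -/
theorem orthogonal_reduction [FiniteDimensional F W] {B : LinearMap.BilinForm F W}
    (hB : B.IsAlt) (hN : B.Nondegenerate) {L N : Submodule F W} (hL : B.orthogonal L = L)
    (hNN : N ≤ B.orthogonal N) :
    B.orthogonal (L ⊓ B.orthogonal N ⊔ N) = L ⊓ B.orthogonal N ⊔ N := by
  have hsup : ∀ P Q : Submodule F W, B.orthogonal (P ⊔ Q) = B.orthogonal P ⊓ B.orthogonal Q := by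
    intro P Q
    refine le_antisymm (le_inf ?_ ?_) ?_
    · exact fun x hx y hy => hx y (Submodule.mem_sup_left hy)
    · exact fun x hx y hy => hx y (Submodule.mem_sup_right hy)
    · rintro x ⟨h1, h2⟩ y hy
      obtain ⟨p, hp, q, hq, rfl⟩ := Submodule.mem_sup.1 hy
      rw [map_add, LinearMap.add_apply, h1 p hp, h2 q hq,
        add_zero]
  have h1 : L ⊓ B.orthogonal N = B.orthogonal (L ⊔ N) := by rw [hsup, hL]
  rw [hsup, h1, LinearMap.BilinForm.orthogonal_orthogonal hN hB.isRefl, ← h1, inf_comm,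
    sup_comm, inf_comm, sup_inf_assoc_of_le _ hNN, sup_comm]

variable {B : LinearMap.BilinForm F W}

theorem doubleForm_apply (x y : W × W) : doubleForm B x y = B x.1 y.1 - B x.2 y.2 := rfl

theorem doubleForm_isAlt (hB : B.IsAlt) : (doubleForm B).IsAlt := fun x => by
  rw [doubleForm_apply, hB.self_eq_zero, hB.self_eq_zero, sub_zero]

theorem doubleForm_nondegenerate (hB : B.IsAlt) (hN : B.Nondegenerate) :
    (doubleForm B).Nondegenerate := by
  have h : (doubleForm B).SeparatingLeft := by
    intro x hx
    refine Prod.ext (hN.1 _ fun y => ?_) (hN.1 _ fun y => ?_)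
    · simpa [doubleForm_apply] using hx (y, 0)
    · simpa [doubleForm_apply] using hx (0, y)
  refine ⟨h, fun y hy => h y fun x => ?_⟩
  rw [← (doubleForm_isAlt hB).neg_eq, hy, neg_zero]

/-- The composite of two linear relations: first `L'`, then `L`. -/
def relComp (L L' : Submodule F (W × W)) : Submodule F (W × W) where
  carrier := {u | ∃ v, (u.1, v) ∈ L' ∧ (v, u.2) ∈ L}
  add_mem' := by
    rintro a b ⟨v, h1, h2⟩ ⟨v', h1', h2'⟩
    exact ⟨v + v', L'.add_mem h1 h1', L.add_mem h2 h2'⟩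
  zero_mem' := ⟨0, L'.zero_mem, L.zero_mem⟩
  smul_mem' := by
    rintro c a ⟨v, h1, h2⟩
    exact ⟨c • v, L'.smul_mem c h1, L.smul_mem c h2⟩

/-- The composite of two Lagrangian relations is Lagrangian. -/
theorem relComp_isLagrangian [FiniteDimensional F W] (hB : B.IsAlt) (hN : B.Nondegenerate)
    {L L' : Submodule F (W × W)} (hL : IsLagrangian (doubleForm B) L)
    (hL' : IsLagrangian (doubleForm B) L') : IsLagrangian (doubleForm B) (relComp L L') := by
  have hD := doubleForm_isAlt hB
  have hDN := doubleForm_nondegenerate hB hN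
  rw [isLagrangian_iff_orthogonal_eq hD] at hL hL' ⊢
  set Ω : LinearMap.BilinForm F ((W × W) × (W × W)) :=
    (doubleForm B).compl₁₂ (LinearMap.fst F _ _) (LinearMap.fst F _ _) +
      (doubleForm B).compl₁₂ (LinearMap.snd F _ _) (LinearMap.snd F _ _) with hΩ
  have hΩa : ∀ x y, Ω x y = doubleForm B x.1 y.1 + doubleForm B x.2 y.2 := fun x y => rfl
  have hΩalt : Ω.IsAlt := fun x => by rw [hΩa, hD.self_eq_zero, hD.self_eq_zero, add_zero]
  have hΩN : Ω.Nondegenerate := by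
    have h : Ω.SeparatingLeft := by
      intro x hx
      refine Prod.ext (hDN.1 _ fun y => ?_) (hDN.1 _ fun y => ?_)
      · simpa [hΩa] using hx (y, 0)
      · simpa [hΩa] using hx (0, y)
    refine ⟨h, fun y hy => h y fun x => ?_⟩
    rw [← hΩalt.neg_eq, hy, neg_zero]
  have hK : Ω.orthogonal (L'.prod L) = L'.prod L := by
    refine le_antisymm (fun x hx => ?_) fun x hx y hy => ?_
    · constructor
      · rw [← hL']
        intro y hy
        have := hx (y, 0) ⟨hy, L.zero_mem⟩
        simpa [hΩa] using this
      · rw [← hL]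
        intro y hy
        have := hx (0, y) ⟨L'.zero_mem, hy⟩
        simpa [hΩa] using this
    · have h1 : x.1 ∈ L' := hx.1
      have h2 : x.2 ∈ L := hx.2
      rw [← hL'] at h1
      rw [← hL] at h2
      rw [hΩa, h1 y.1 hy.1, h2 y.2 hy.2, add_zero]
  let N : Submodule F ((W × W) × (W × W)) :=
    LinearMap.range ((LinearMap.inr F W W).prod (LinearMap.inl F W W))
  have hNo : ∀ x, x ∈ Ω.orthogonal N ↔ x.1.2 = x.2.1 := by
    intro x
    constructor
    · intro h
      rw [← sub_eq_zero]
      refine hN.2 _ fun b => ?_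
      have := h ((0, b), (b, 0)) ⟨b, rfl⟩
      simp only [hΩa, doubleForm_apply, map_zero,
        LinearMap.zero_apply] at this
      rw [map_sub, ← neg_eq_zero, ← this]
      ring
    · rintro h _ ⟨b, rfl⟩
      simp [hΩa, doubleForm_apply, h]
  have hNN : N ≤ Ω.orthogonal N := by
    rintro _ ⟨b, rfl⟩
    rw [hNo]
    rfl
  have hred := orthogonal_reduction hΩalt hΩN hK hNN
  refine le_antisymm (fun x hx => ?_) ?_
  · have : ((x.1, (0 : W)), ((0 : W), x.2)) ∈ Ω.orthogonal (L'.prod L ⊓ Ω.orthogonal N ⊔ N) := by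
      intro y hy
      obtain ⟨k, ⟨hk, hk'⟩, _, ⟨b, rfl⟩, rfl⟩ := Submodule.mem_sup.1 hy
      have hk2 := (hNo k).1 hk'
      have := hx (k.1.1, k.2.2) ⟨k.1.2, hk.1, by rw [hk2]; exact hk.2⟩
      simp only [doubleForm_apply] at this
      simp only [hΩa, doubleForm_apply]
      simpa [sub_eq_add_neg] using this
    rw [hred] at this
    obtain ⟨k, ⟨hk, hk'⟩, _, ⟨b, rfl⟩, he⟩ := Submodule.mem_sup.1 this
    have hk2 := (hNo k).1 hk'
    have e1 : k.1.1 = x.1 := by simpa using congrArg (fun z => z.1.1) he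
    have e2 : k.2.2 = x.2 := by simpa using congrArg (fun z => z.2.2) he
    refine ⟨k.1.2, by rw [← e1]; exact hk.1, ?_⟩
    rw [hk2, ← e2]
    exact hk.2
  · rintro x ⟨v, hv, hv'⟩ y ⟨w, hw, hw'⟩
    rw [← hL'] at hv
    rw [← hL] at hv'
    have h1 := hv _ hw
    have h2 := hv' _ hw'
    simp only [doubleForm_apply] at h1 h2 ⊢
    rw [← add_zero (0 : F)]
    nth_rw 1 [← h1]
    rw [← h2]
    ring

end Lagrangian

section CharacterSums

variable {F K : Type*} [Field F] [AddCommGroup K] [Module F K] [Fintype K]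

theorem sum_addChar_linear_eq_zero {χ : AddChar F ℂ} (hχ : χ ≠ 1) {l : K →ₗ[F] F} (hl : l ≠ 0) :
    ∑ x, χ (l x) = 0 := by
  have h : χ.compAddMonoidHom l.toAddMonoidHom ≠ 0 := by
    obtain ⟨x, hx⟩ := DFunLike.ne_iff.1 hl
    obtain ⟨t, ht⟩ := DFunLike.ne_iff.1 hχ
    refine DFunLike.ne_iff.2 ⟨(t / l x) • x, ?_⟩
    have e : l ((t / l x) • x) = t := by
      rw [map_smul, smul_eq_mul, div_mul_cancel₀ _ hx]
    change χ (l ((t / l x) • x)) ≠ 1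
    rw [e]
    exact ht
  exact AddChar.sum_eq_zero_iff_ne_zero.2 h

/-- Quadratic Gauss sums do not vanish in odd characteristic. -/
theorem sum_addChar_quadratic_ne_zero {χ : AddChar F ℂ} (hχ : χ ≠ 1) (h2 : (2 : F) ≠ 0)
    (b : LinearMap.BilinForm F K) : ∑ x, χ (b x x) ≠ 0 := by
  classical
  intro h0
  have h1 : (∑ x, χ (b x x)) * ∑ l, χ (-b l l) = ∑ x, χ (b x x) * ∑ l, χ ((b x + LinearMap.flip b x) l) := by
    rw [Finset.sum_mul_sum, Finset.sum_comm]
    simp_rw [Finset.mul_sum]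
    rw [Finset.sum_comm (s := Finset.univ (α := K)) (t := Finset.univ (α := K))
      (f := fun x l => χ (b x x) * χ ((b x + LinearMap.flip b x) l))]
    refine Finset.sum_congr rfl fun l _ => ?_
    rw [← Equiv.sum_comp (Equiv.addRight l)]
    refine Finset.sum_congr rfl fun x _ => ?_
    rw [← AddChar.map_add_eq_mul, ← AddChar.map_add_eq_mul]
    congr 1
    simp only [Equiv.coe_addRight, map_add, LinearMap.add_apply, LinearMap.flip_apply]
    ring
  have h3 : ∀ x, χ (b x x) * ∑ l, χ ((b x + LinearMap.flip b x) l) =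
      if b x + LinearMap.flip b x = 0 then (Fintype.card K : ℂ) else 0 := by
    intro x
    split_ifs with hx
    · have hxx : b x x = 0 := by
        have := LinearMap.congr_fun hx x
        simp only [LinearMap.add_apply, LinearMap.flip_apply, LinearMap.zero_apply,
          ← two_mul] at this
        exact (mul_eq_zero.1 this).resolve_left h2
      rw [hxx, hx]
      simp
    · rw [sum_addChar_linear_eq_zero hχ hx, mul_zero]
  rw [h0, zero_mul, Finset.sum_congr rfl fun x _ => h3 x, Finset.sum_ite] at h1
  simp only [Finset.sum_const, nsmul_eq_mul, add_zero, mul_zero] at h1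
  have h4 : (0 : K) ∈ Finset.univ.filter fun x => b x + LinearMap.flip b x = 0 := by simp
  rcases mul_eq_zero.1 h1.symm with h | h
  · rw [Nat.cast_eq_zero, Finset.card_eq_zero] at h
    rw [h] at h4
    simp at h4
  · exact Fintype.card_ne_zero (Nat.cast_eq_zero.1 h)

end CharacterSums

section Heis

variable {F W V : Type*} [Field F] [AddCommGroup W] [Module F W] [AddCommGroup V] [Module ℂ V]
  {B : LinearMap.BilinForm F W} {ρ : Representation ℂ (Heisenberg B) V} {χ : AddChar F ℂ}

theorem rho_vec_scal (hρ : HasCentralCharacter ρ χ) (w : W) (t : F) :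
    ρ ⟨w, t⟩ = χ t • ρ ⟨w, 0⟩ := by
  have : (⟨w, t⟩ : Heisenberg B) = ⟨0, t⟩ * ⟨w, 0⟩ := by simp [Heisenberg.mul_def]
  rw [this, map_mul, hρ t, smul_mul_assoc, one_mul]

theorem rho_mul (hρ : HasCentralCharacter ρ χ) (a b : W) :
    ρ ⟨a, 0⟩ * ρ ⟨b, 0⟩ = χ ((2 : F)⁻¹ * B a b) • ρ ⟨a + b, 0⟩ := by
  rw [← map_mul, Heisenberg.mul_def, ← rho_vec_scal hρ]
  simp

theorem rho_zero : ρ ⟨0, 0⟩ = 1 := map_one ρ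

theorem rho_mul_rho_neg (hB : B.IsAlt) (hρ : HasCentralCharacter ρ χ) (a : W) :
    ρ ⟨a, 0⟩ * ρ ⟨-a, 0⟩ = 1 := by
  rw [rho_mul hρ, map_neg, hB.self_eq_zero]
  simp [rho_zero]

theorem rho_neg_mul_rho (hB : B.IsAlt) (hρ : HasCentralCharacter ρ χ) (a : W) :
    ρ ⟨-a, 0⟩ * ρ ⟨a, 0⟩ = 1 := by
  have := rho_mul_rho_neg hB hρ (-a)
  rwa [neg_neg] at this

/-- Conjugation by `ρ z` multiplies `ρ w` by `χ ⟨z, w⟩`. -/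
theorem rho_conj (hB : B.IsAlt) (h2 : (2 : F) ≠ 0) (hρ : HasCentralCharacter ρ χ) (z w : W) :
    ρ ⟨z, 0⟩ * ρ ⟨w, 0⟩ * ρ ⟨-z, 0⟩ = χ (B z w) • ρ ⟨w, 0⟩ := by
  rw [rho_mul hρ, smul_mul_assoc, rho_mul hρ, smul_smul, ← AddChar.map_add_eq_mul]
  congr 2
  · have : B w z = -B z w := (hB.neg_eq z w).symm
    simp only [map_add, map_neg, LinearMap.add_apply, hB.self_eq_zero, this]
    field_simp
    ring
  · simp

theorem heisenberg_finite [Finite F] [Finite W] : Finite (Heisenberg B) :=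
  Finite.of_injective (fun a : Heisenberg B => (a.vec, a.scal)) fun _ _ h =>
    Heisenberg.ext (congrArg Prod.fst h) (congrArg Prod.snd h)

theorem eq_bot_or_eq_top_of_invariant (hIrr : ρ.IsIrreducible) (U : Submodule ℂ V)
    (hU : ∀ h, ∀ v ∈ U, ρ h v ∈ U) : U = ⊥ ∨ U = ⊤ := by
  have := hIrr
  rcases eq_bot_or_eq_top (⟨U, hU⟩ : Subrepresentation ρ) with h | h
  · exact Or.inl (congrArg Subrepresentation.toSubmodule h)
  · exact Or.inr (congrArg Subrepresentation.toSubmodule h)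

theorem nontrivial_of_isIrreducible (hIrr : ρ.IsIrreducible) : Nontrivial V := by
  have := hIrr
  by_contra h
  rw [not_nontrivial_iff_subsingleton] at h
  refine bot_ne_top (α := Subrepresentation ρ) ?_
  exact Subrepresentation.toSubmodule_injective (Subsingleton.elim _ _)

theorem finiteDimensional_of_isIrreducible [Finite F] [Finite W] (hIrr : ρ.IsIrreducible) :
    FiniteDimensional ℂ V := by
  have := nontrivial_of_isIrreducible hIrr
  have := heisenberg_finite (B := B)
  obtain ⟨v, hv⟩ := exists_ne (0 : V)
  set U := Submodule.span ℂ (Set.range fun h => ρ h v) with hUdef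
  have hU : U = ⊥ ∨ U = ⊤ := by
    refine eq_bot_or_eq_top_of_invariant hIrr U fun h x hx => ?_
    induction hx using Submodule.span_induction with
    | mem x hx =>
      obtain ⟨k, rfl⟩ := hx
      refine Submodule.subset_span ⟨h * k, ?_⟩
      simp
    | zero => simp
    | add x y _ _ hx hy => rw [map_add]; exact U.add_mem hx hy
    | smul c x _ hx => rw [map_smul]; exact U.smul_mem c hx
  have hvU : v ∈ U := Submodule.subset_span ⟨1, by simp⟩
  have hfg : U.FG := Submodule.fg_span (Set.finite_range _)
  rcases hU with h | h
  · rw [h, Submodule.mem_bot] at hvU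
    exact absurd hvU hv
  · exact ⟨h ▸ hfg⟩

/-- Schur's lemma. -/
theorem exists_eq_smul_one_of_commute [FiniteDimensional ℂ V] (hIrr : ρ.IsIrreducible)
    (hρ : HasCentralCharacter ρ χ)
    {T : Module.End ℂ V} (hT : ∀ w, ρ ⟨w, 0⟩ * T = T * ρ ⟨w, 0⟩) :
    ∃ c : ℂ, T = c • (1 : Module.End ℂ V) := by
  have := nontrivial_of_isIrreducible hIrr
  obtain ⟨c, hc⟩ := Module.End.exists_eigenvalue T
  refine ⟨c, ?_⟩
  rcases eq_bot_or_eq_top_of_invariant hIrr (Module.End.eigenspace T c) (by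
    rintro ⟨w, t⟩ v hv
    rw [Module.End.mem_eigenspace_iff] at hv ⊢
    rw [rho_vec_scal hρ, LinearMap.smul_apply, map_smul]
    have := LinearMap.congr_fun (hT w) v
    rw [Module.End.mul_apply, Module.End.mul_apply, hv, map_smul] at this
    rw [← this, smul_comm]) with h | h
  · exact absurd h hc
  · ext v
    have : v ∈ Module.End.eigenspace T c := by rw [h]; trivial
    rw [Module.End.mem_eigenspace_iff] at this
    simp [this]

/-- The operators `ρ w`, `w ∈ W`, span all operators. -/
theorem exists_eq_sum_rho [Fintype W] [FiniteDimensional ℂ V] (h2 : (2 : F) ≠ 0)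
    (hB : B.IsAlt) (hN : B.Nondegenerate) (hχ : χ ≠ 1) (hIrr : ρ.IsIrreducible)
    (hρ : HasCentralCharacter ρ χ) (T : Module.End ℂ V) :
    ∃ a : W → ℂ, T = ∑ w, a w • ρ ⟨w, 0⟩ := by
  classical
  have hP : ∀ X : Module.End ℂ V, ∃ c : ℂ, ∑ z, ρ ⟨z, 0⟩ * X * ρ ⟨-z, 0⟩ = c • 1 := by
    intro X
    refine exists_eq_smul_one_of_commute hIrr hρ fun w => ?_
    rw [Finset.mul_sum, Finset.sum_mul]
    conv_rhs => rw [← Equiv.sum_comp (Equiv.addLeft w)]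
    refine Finset.sum_congr rfl fun z _ => ?_
    simp only [Equiv.coe_addLeft]
    rw [← mul_assoc, ← mul_assoc, rho_mul hρ, mul_assoc _ _ (ρ ⟨w, 0⟩), rho_mul hρ]
    have e1 : -(w + z) + w = -z := by abel
    have e2 : B (-(w + z)) w = B w z := by
      rw [neg_add, map_add, LinearMap.add_apply, map_neg, map_neg, LinearMap.neg_apply,
        LinearMap.neg_apply, hB.self_eq_zero, hB.neg_eq, neg_zero, zero_add]
    rw [e1, e2, smul_mul_assoc, smul_mul_assoc, mul_smul_comm]
  choose c hc using hP
  have hsum : ∑ w, c (T * ρ ⟨-w, 0⟩) • ρ ⟨w, 0⟩ = (Fintype.card W : ℂ) • T := by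
    have h1 : ∀ w, c (T * ρ ⟨-w, 0⟩) • ρ ⟨w, 0⟩ =
        ∑ z, χ (LinearMap.flip B z w) • (ρ ⟨z, 0⟩ * T * ρ ⟨-z, 0⟩) := by
      intro w
      have : c (T * ρ ⟨-w, 0⟩) • ρ ⟨w, 0⟩ = (c (T * ρ ⟨-w, 0⟩) • 1) * ρ ⟨w, 0⟩ := by
        rw [smul_mul_assoc, one_mul]
      rw [this, ← hc, Finset.sum_mul]
      refine Finset.sum_congr rfl fun z _ => ?_
      have h3 := rho_conj hB h2 hρ (-w) (-z)
      have e : B (-w) (-z) = B w z := by simp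
      rw [neg_neg, e] at h3
      rw [LinearMap.flip_apply, ← mul_smul_comm, ← h3]
      simp only [mul_assoc]
    rw [Finset.sum_congr rfl fun w _ => h1 w, Finset.sum_comm]
    simp_rw [← Finset.sum_smul]
    rw [Finset.sum_eq_single 0]
    · simp [rho_zero]
    · intro z _ hz
      have hz' : LinearMap.flip B z ≠ 0 := fun h => hz (hN.2 z fun y => LinearMap.congr_fun h y)
      rw [sum_addChar_linear_eq_zero hχ hz', zero_smul]
    · simp
  have hcard : (Fintype.card W : ℂ) ≠ 0 := Nat.cast_ne_zero.2 Fintype.card_ne_zero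
  refine ⟨fun w => (Fintype.card W : ℂ)⁻¹ * c (T * ρ ⟨-w, 0⟩), ?_⟩
  simp_rw [mul_smul]
  rw [← Finset.smul_sum, hsum, smul_smul, inv_mul_cancel₀ hcard, one_smul]

theorem exists_addChar_ne_one (hχ : χ ≠ 1) {a : F} (ha : a ≠ 0) : ∃ t : F, χ (t * a) ≠ 1 := by
  obtain ⟨t, ht⟩ := DFunLike.ne_iff.1 hχ
  exact ⟨t / a, by rwa [div_mul_cancel₀ _ ha]⟩

theorem trace_rho_eq_zero (h2 : (2 : F) ≠ 0)
    (hB : B.IsAlt) (hN : B.Nondegenerate) (hχ : χ ≠ 1)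
    (hρ : HasCentralCharacter ρ χ) {w : W} (hw : w ≠ 0) :
    LinearMap.trace ℂ V (ρ ⟨w, 0⟩) = 0 := by
  obtain ⟨z, hz⟩ : ∃ z, B z w ≠ 0 := by
    by_contra! h
    exact hw (hN.2 w h)
  obtain ⟨t, ht⟩ := exists_addChar_ne_one hχ hz
  have h1 := congrArg (LinearMap.trace ℂ V) (rho_conj hB h2 hρ (t • z) w)
  rw [LinearMap.trace_mul_comm, ← mul_assoc, rho_neg_mul_rho hB hρ, one_mul, map_smul, map_smul,
    LinearMap.smul_apply, smul_eq_mul, smul_eq_mul] at h1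
  have h3 : (χ (t * B z w) - 1) * LinearMap.trace ℂ V (ρ ⟨w, 0⟩) = 0 := by
    rw [sub_mul, ← h1]; ring
  exact (mul_eq_zero.1 h3).resolve_left (sub_ne_zero.2 ht)

/-! ### The operators attached to Lagrangian relations -/

theorem doubleAction_add (hB : B.IsAlt) (hρ : HasCentralCharacter ρ χ) (u u' : W × W)
    (A : Module.End ℂ V) :
    doubleAction ρ u (doubleAction ρ u' A) =
      χ (-((2 : F)⁻¹ * doubleForm B u u')) • doubleAction ρ (u + u') A := by
  have e : doubleAction ρ u (doubleAction ρ u' A) =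
      (ρ ⟨u.2, 0⟩ * ρ ⟨u'.2, 0⟩) * A * (ρ ⟨-u'.1, 0⟩ * ρ ⟨-u.1, 0⟩) := by
    simp only [doubleAction, mul_assoc]
  rw [e, rho_mul hρ, rho_mul hρ, smul_mul_assoc, smul_mul_assoc, mul_smul_comm, smul_smul,
    ← AddChar.map_add_eq_mul, doubleForm_apply, doubleAction]
  have h1 : -u'.1 + -u.1 = -(u + u').1 := by simp [add_comm]
  have h3 : B (-u'.1) (-u.1) = -B u.1 u'.1 := by
    rw [map_neg, map_neg, LinearMap.neg_apply, neg_neg, hB.neg_eq]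
  rw [h1, h3, Prod.snd_add]
  congr 2
  ring

theorem doubleAction_one (hρ : HasCentralCharacter ρ χ) (u : W × W) :
    doubleAction ρ u 1 = χ (-((2 : F)⁻¹ * B u.2 u.1)) • ρ ⟨u.2 - u.1, 0⟩ := by
  rw [doubleAction, mul_one, rho_mul hρ, map_neg, mul_neg, sub_eq_add_neg]

/-- The linear map underlying `doubleAction`. -/
def doubleActionHom (ρ : Representation ℂ (Heisenberg B) V) (u : W × W) :
    Module.End ℂ V →ₗ[ℂ] Module.End ℂ V where
  toFun := doubleAction ρ u
  map_add' a b := by simp [doubleAction, mul_add, add_mul]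
  map_smul' c a := by simp [doubleAction]

theorem doubleActionHom_apply (u : W × W) (A : Module.End ℂ V) :
    doubleActionHom ρ u A = doubleAction ρ u A := rfl

/-- Every operator fixed by a Lagrangian relation `L` is a multiple of `∑ u ∈ L, u · 1`. -/
theorem exists_eq_smul_sum_doubleAction [Fintype W] [FiniteDimensional F W]
    [FiniteDimensional ℂ V] (h2 : (2 : F) ≠ 0)
    (hB : B.IsAlt) (hN : B.Nondegenerate) (hχ : χ ≠ 1) (hIrr : ρ.IsIrreducible)
    (hρ : HasCentralCharacter ρ χ) {L : Submodule F (W × W)} [Fintype L]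
    (hL : IsLagrangian (doubleForm B) L) {A : Module.End ℂ V}
    (hA : ∀ u ∈ L, doubleAction ρ u A = A) :
    ∃ c : ℂ, A = c • ∑ u : L, doubleAction ρ u 1 := by
  have hadd : ∀ u : L, ∀ u' : L, ∀ X : Module.End ℂ V,
      doubleAction ρ (u : W × W) (doubleAction ρ u' X) = doubleAction ρ ((u + u' : L) : W × W) X := by
    intro u u' X
    rw [doubleAction_add hB hρ, hL.1 _ u.2 _ u'.2]
    simp
  have hshift : ∀ u' : L, ∀ X : Module.End ℂ V,
      ∑ u : L, doubleAction ρ (u : W × W) (doubleAction ρ u' X) = ∑ u : L, doubleAction ρ u X := by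
    intro u' X
    simp_rw [hadd]
    exact Equiv.sum_comp (Equiv.addRight u') fun u : L => doubleAction ρ (u : W × W) X
  have hw : ∀ w : W, ∃ c : ℂ, ∑ u : L, doubleAction ρ u (ρ ⟨w, 0⟩) =
      c • ∑ u : L, doubleAction ρ u 1 := by
    intro w
    set U : Submodule F W := L.map (LinearMap.snd F W W - LinearMap.fst F W W) with hU
    by_cases hwU : w ∈ U
    · obtain ⟨u₀, hu₀, rfl⟩ := hwU
      refine ⟨χ ((2 : F)⁻¹ * B u₀.2 u₀.1), ?_⟩
      have : ρ ⟨u₀.2 - u₀.1, 0⟩ = χ ((2 : F)⁻¹ * B u₀.2 u₀.1) • doubleAction ρ u₀ 1 := by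
        rw [doubleAction_one hρ, smul_smul, ← AddChar.map_add_eq_mul, add_neg_cancel,
          AddChar.map_zero_eq_one, one_smul]
      simp only [LinearMap.sub_apply, LinearMap.snd_apply, LinearMap.fst_apply]
      rw [this]
      simp_rw [← doubleActionHom_apply, map_smul, ← Finset.smul_sum, doubleActionHom_apply]
      rw [hshift ⟨u₀, hu₀⟩]
    · refine ⟨0, ?_⟩
      obtain ⟨m, hm, hmw⟩ : ∃ m ∈ B.orthogonal U, B m w ≠ 0 := by
        by_contra! h
        refine hwU ?_
        rw [← LinearMap.BilinForm.orthogonal_orthogonal hN hB.isRefl U]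
        exact h
      obtain ⟨t, ht⟩ := exists_addChar_ne_one hχ hmw
      have hmL : (t • m, t • m) ∈ L := by
        have hL' := (isLagrangian_iff_orthogonal_eq (doubleForm_isAlt hB)).1 hL
        rw [← hL']
        intro u hu
        have := hm (u.2 - u.1) ⟨u, hu, rfl⟩
        rw [map_sub, LinearMap.sub_apply, sub_eq_zero] at this
        rw [doubleForm_apply, map_smul, map_smul, this, sub_self]
      have h1 := hshift ⟨_, hmL⟩ (ρ ⟨w, 0⟩)
      have h3 : doubleAction ρ (t • m, t • m) (ρ ⟨w, 0⟩) = χ (t * B m w) • ρ ⟨w, 0⟩ := by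
        rw [doubleAction, rho_conj hB h2 hρ, map_smul, LinearMap.smul_apply, smul_eq_mul]
      simp only at h1
      rw [h3] at h1
      simp_rw [← doubleActionHom_apply, map_smul, ← Finset.smul_sum, doubleActionHom_apply] at h1
      rw [zero_smul]
      have h4 : (χ (t * B m w) - 1) • ∑ u : L, doubleAction ρ u (ρ ⟨w, 0⟩) = 0 := by
        rw [sub_smul, h1, one_smul, sub_self]
      exact (smul_eq_zero.1 h4).resolve_left (sub_ne_zero.2 ht)
  choose c hc using hw
  obtain ⟨a, ha⟩ := exists_eq_sum_rho h2 hB hN hχ hIrr hρ A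
  have h1 : (Fintype.card L : ℂ) • A = (∑ w, a w * c w) • ∑ u : L, doubleAction ρ u 1 := by
    calc (Fintype.card L : ℂ) • A = ∑ u : L, doubleAction ρ u A := by
          rw [Finset.sum_congr rfl fun (u : L) _ => hA u u.2]
          simp [Nat.cast_smul_eq_nsmul]
      _ = ∑ w, a w • ∑ u : L, doubleAction ρ u (ρ ⟨w, 0⟩) := by
          simp_rw [← doubleActionHom_apply]
          rw [ha]
          simp_rw [map_sum, map_smul, Finset.smul_sum]
          exact Finset.sum_comm
      _ = _ := by
          simp_rw [hc, smul_smul, Finset.sum_smul]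
  have hcard : (Fintype.card L : ℂ) ≠ 0 := Nat.cast_ne_zero.2 Fintype.card_ne_zero
  refine ⟨(Fintype.card L : ℂ)⁻¹ * ∑ w, a w * c w, ?_⟩
  rw [mul_smul, ← h1, smul_smul, inv_mul_cancel₀ hcard, one_smul]

/-- The operators attached to two relations have a product of non-zero trace. -/
theorem trace_sum_mul_sum_ne_zero (h2 : (2 : F) ≠ 0) [FiniteDimensional ℂ V]
    (hB : B.IsAlt) (hN : B.Nondegenerate) (hχ : χ ≠ 1) (hIrr : ρ.IsIrreducible)
    (hρ : HasCentralCharacter ρ χ) (L L' : Submodule F (W × W)) [Fintype L] [Fintype L'] :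
    LinearMap.trace ℂ V ((∑ u : L, doubleAction ρ u 1) * ∑ u : L', doubleAction ρ u 1) ≠ 0 := by
  classical
  have := nontrivial_of_isIrreducible hIrr
  let p : L →ₗ[F] W × W := L.subtype
  let p' : L' →ₗ[F] W × W := L'.subtype
  let d : W × W →ₗ[F] W := LinearMap.snd F W W - LinearMap.fst F W W
  let K : Submodule F (L × L') :=
    LinearMap.ker (d ∘ₗ p ∘ₗ LinearMap.fst F L L' + d ∘ₗ p' ∘ₗ LinearMap.snd F L L')
  let b₀ : LinearMap.BilinForm F (W × W) := B.compl₁₂ (LinearMap.snd F W W) (LinearMap.fst F W W)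
  let b : LinearMap.BilinForm F (L × L') :=
    (-(2 : F)⁻¹) • (b₀.compl₁₂ (p ∘ₗ LinearMap.fst F L L') (p ∘ₗ LinearMap.fst F L L') +
      b₀.compl₁₂ (p' ∘ₗ LinearMap.snd F L L') (p' ∘ₗ LinearMap.snd F L L'))
  have htr : ∀ x : L × L', LinearMap.trace ℂ V
      (doubleAction ρ (x.1 : W × W) 1 * doubleAction ρ (x.2 : W × W) 1) =
      if x ∈ K then (Module.finrank ℂ V : ℂ) * χ (b x x) else 0 := by
    rintro ⟨⟨u, hu⟩, ⟨u', hu'⟩⟩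
    have hK : (⟨⟨u, hu⟩, ⟨u', hu'⟩⟩ : L × L') ∈ K ↔ (u.2 - u.1) + (u'.2 - u'.1) = 0 := Iff.rfl
    have hb : b ⟨⟨u, hu⟩, ⟨u', hu'⟩⟩ ⟨⟨u, hu⟩, ⟨u', hu'⟩⟩ =
      -(2 : F)⁻¹ * (B u.2 u.1 + B u'.2 u'.1) := rfl
    rw [hK, hb, doubleAction_one hρ, doubleAction_one hρ, smul_mul_smul_comm, rho_mul hρ, smul_smul,
      map_smul, smul_eq_mul]
    split_ifs with h
    · have h3 : B (u.2 - u.1) (u'.2 - u'.1) = 0 := by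
        rw [← neg_eq_of_add_eq_zero_right h, map_neg, hB.self_eq_zero, neg_zero]
      rw [h, h3, rho_zero, LinearMap.trace_one, mul_zero, AddChar.map_zero_eq_one, mul_one,
        ← AddChar.map_add_eq_mul, mul_comm]
      congr 2
      ring
    · rw [trace_rho_eq_zero h2 hB hN hχ hρ h, mul_zero]
  rw [Finset.sum_mul_sum, ← Finset.sum_product', map_sum, Finset.univ_product_univ,
    Finset.sum_congr rfl fun x _ => htr x, ← Finset.sum_filter, ← Finset.mul_sum]
  refine mul_ne_zero (Nat.cast_ne_zero.2 Module.finrank_pos.ne') ?_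
  have h3 := sum_addChar_quadratic_ne_zero (K := K) hχ h2 (b.restrict K)
  convert h3 using 1
  rw [← Finset.sum_subtype_eq_sum_filter, Finset.subtype_univ]
  rfl

/-- The oscillator semigroup is closed under multiplication. -/
theorem mul_mem_oscillatorSemigroup [Finite W] [FiniteDimensional F W]
    [FiniteDimensional ℂ V] (h2 : (2 : F) ≠ 0)
    (hB : B.IsAlt) (hN : B.Nondegenerate) (hχ : χ ≠ 1) (hIrr : ρ.IsIrreducible)
    (hρ : HasCentralCharacter ρ χ) {A A' : Module.End ℂ V} (hA : A ∈ oscillatorSemigroup ρ)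
    (hA' : A' ∈ oscillatorSemigroup ρ) : A * A' ∈ oscillatorSemigroup ρ := by
  obtain ⟨L, hL, hA0, hAL⟩ := hA
  obtain ⟨L', hL', hA0', hAL'⟩ := hA'
  have := Fintype.ofFinite W
  have := Fintype.ofFinite L
  have := Fintype.ofFinite L'
  refine ⟨relComp L L', relComp_isLagrangian hB hN hL hL', ?_, ?_⟩
  · obtain ⟨c, hc⟩ := exists_eq_smul_sum_doubleAction h2 hB hN hχ hIrr hρ hL hAL
    obtain ⟨c', hc'⟩ := exists_eq_smul_sum_doubleAction h2 hB hN hχ hIrr hρ hL' hAL'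
    intro h0
    have h1 := trace_sum_mul_sum_ne_zero h2 hB hN hχ hIrr hρ L L'
    rw [hc, hc', smul_mul_smul_comm] at h0
    rcases smul_eq_zero.1 h0 with h | h
    · rcases mul_eq_zero.1 h with h | h
      · exact hA0 (by rw [hc, h, zero_smul])
      · exact hA0' (by rw [hc', h, zero_smul])
    · rw [h, map_zero] at h1
      exact h1 rfl
  · rintro ⟨w, w''⟩ ⟨v, h1, h3⟩
    have e1 := hAL _ h3
    have e2 := hAL' _ h1
    simp only [doubleAction] at e1 e2 ⊢
    calc ρ ⟨w'', 0⟩ * (A * A') * ρ ⟨-w, 0⟩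
        = ρ ⟨w'', 0⟩ * A * (ρ ⟨-v, 0⟩ * ρ ⟨v, 0⟩) * A' * ρ ⟨-w, 0⟩ := by
          rw [rho_neg_mul_rho hB hρ]; simp [mul_assoc]
      _ = (ρ ⟨w'', 0⟩ * A * ρ ⟨-v, 0⟩) * (ρ ⟨v, 0⟩ * A' * ρ ⟨-w, 0⟩) := by simp only [mul_assoc]
      _ = A * A' := by rw [e1, e2]

end Heis

section GroupAlgebra

variable (F Γ : Type*) [Field F] [Group Γ]

/-- The anti-automorphism `g ↦ g⁻¹` of the group algebra. -/
noncomputable def groupAlgebraInv : MonoidAlgebra F Γ →ₐ[F] (MonoidAlgebra F Γ)ᵐᵒᵖ :=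
  MonoidAlgebra.lift F _ Γ
    { toFun := fun g => MulOpposite.op (MonoidAlgebra.of F Γ g⁻¹)
      map_one' := by rw [inv_one, map_one, MulOpposite.op_one]
      map_mul' := fun g h => by rw [← MulOpposite.op_mul, ← map_mul, mul_inv_rev] }

theorem groupAlgebraInv_of (g : Γ) :
    groupAlgebraInv F Γ (MonoidAlgebra.of F Γ g) = MulOpposite.op (MonoidAlgebra.of F Γ g⁻¹) :=
  MonoidAlgebra.lift_of _ _

/-- The involution `g ↦ g⁻¹` of the group algebra. -/
noncomputable abbrev groupAlgebraStarRing : StarRing (MonoidAlgebra F Γ) where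
  star x := (groupAlgebraInv F Γ x).unop
  star_involutive x := by
    induction x using MonoidAlgebra.induction_on with
    | of g => simp only [groupAlgebraInv_of, MulOpposite.unop_op, inv_inv]
    | add x y hx hy =>
      beta_reduce at hx hy ⊢
      rw [map_add, MulOpposite.unop_add, map_add, MulOpposite.unop_add, hx, hy]
    | smul r x hx =>
      beta_reduce at hx ⊢
      rw [map_smul, MulOpposite.unop_smul, map_smul, MulOpposite.unop_smul, hx]
  star_mul x y := by rw [map_mul, MulOpposite.unop_mul]
  star_add x y := by rw [map_add, MulOpposite.unop_add]

variable {F Γ} {W : Type*} [AddCommGroup W] [Module F W]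

theorem asAlgebraHom_adjoint (B : LinearMap.BilinForm F W) (τ : Representation F Γ W)
    (hτ : ∀ g x y, B (τ g x) (τ g y) = B x y) (s : MonoidAlgebra F Γ) (x y : W) :
    B (τ.asAlgebraHom s x) y = B x (τ.asAlgebraHom (groupAlgebraInv F Γ s).unop y) := by
  induction s using MonoidAlgebra.induction_on with
  | of g =>
    rw [groupAlgebraInv_of, MulOpposite.unop_op, Representation.asAlgebraHom_of,
      Representation.asAlgebraHom_of, ← hτ g x, ← Module.End.mul_apply (τ g), ← map_mul,
      mul_inv_cancel, map_one, Module.End.one_apply]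
  | add s t hs ht => simp only [map_add, LinearMap.add_apply, MulOpposite.unop_add, hs, ht]
  | smul r s hs => simp only [map_smul, LinearMap.smul_apply, MulOpposite.unop_smul, hs]

/-- Two vectors which cannot be told apart by invariant subspaces and invariant symmetric bilinear
forms on them are conjugate by an isometry in the image of the group algebra. -/
theorem exists_isometry_mem_groupAlgebra [Finite F] [Finite Γ] (h2 : (2 : F) ≠ 0)
    (B : LinearMap.BilinForm F W) (τ : Representation F Γ W)
    (hτ : ∀ g x y, B (τ g x) (τ g y) = B x y) {u v : W}
    (hU : ∀ U : Submodule F W, (∀ g, ∀ x ∈ U, τ g x ∈ U) → (u ∈ U ↔ v ∈ U))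
    (hβ : ∀ U : Submodule F W, (∀ g, ∀ x ∈ U, τ g x ∈ U) → ∀ β : LinearMap.BilinForm F W,
      (∀ x y, β x y = β y x) → (∀ g, ∀ x ∈ U, ∀ y ∈ U, β (τ g x) (τ g y) = β x y) →
      u ∈ U → v ∈ U → β u u = β v v) :
    ∃ s t : MonoidAlgebra F Γ, s * t = 1 ∧ t * s = 1 ∧ τ.asAlgebraHom s u = v ∧
      ∀ x y, B (τ.asAlgebraHom s x) (τ.asAlgebraHom s y) = B x y := by
  let S := MonoidAlgebra F Γ
  let _ : StarRing S := groupAlgebraStarRing F Γ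
  have hfin : Finite S := by
    refine Finite.of_injective (fun (x : S) g => x.coeff g) fun x y h => ?_
    exact MonoidAlgebra.coeff_injective (DFunLike.coe_injective h)
  have hstar_smul : ∀ (c : F) (s : S), star (c • s) = c • star s := fun c s => by
    change (groupAlgebraInv F Γ (c • s)).unop = c • (groupAlgebraInv F Γ s).unop
    rw [map_smul, MulOpposite.unop_smul]
  have hstar_of : ∀ g : Γ, star (MonoidAlgebra.of F Γ g : S) = MonoidAlgebra.of F Γ g⁻¹ :=
    fun g => congrArg MulOpposite.unop (groupAlgebraInv_of F Γ g)
  have h2S : IsUnit (2 : S) := by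
    have := (IsUnit.mk0 (2 : F) h2).map (algebraMap F S)
    rwa [map_ofNat] at this
  let φ := τ.asAlgebraHom
  have hφof : ∀ g, φ (MonoidAlgebra.of F Γ g) = τ g := fun g => τ.asAlgebraHom_of g
  have hφmul : ∀ (s t : S) (w : W), φ (s * t) w = φ s (φ t w) := fun s t w => by
    rw [map_mul, Module.End.mul_apply]
  let ev : W → S →ₗ[F] W := fun w => (LinearMap.applyₗ w) ∘ₗ φ.toLinearMap
  have hev : ∀ w s, ev w s = φ s w := fun w s => rfl
  have hev_stable : ∀ w, ∀ g, ∀ x ∈ LinearMap.range (ev w), τ g x ∈ LinearMap.range (ev w) := by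
    rintro w g _ ⟨s, rfl⟩
    exact ⟨MonoidAlgebra.of F Γ g * s, by rw [hev, hev, hφmul, hφof]⟩
  have hev_self : ∀ w, w ∈ LinearMap.range (ev w) := fun w => ⟨1, by rw [hev, map_one]; rfl⟩
  obtain ⟨h, hh⟩ := (hU _ (hev_stable u)).1 (hev_self u)
  obtain ⟨h', hh'⟩ := (hU _ (hev_stable v)).2 (hev_self v)
  rw [hev] at hh hh'
  let I : Ideal S :=
    { carrier := {s | φ s u = 0}
      add_mem' := fun {a b} (ha : φ a u = 0) (hb : φ b u = 0) => by
        change φ (a + b) u = 0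
        rw [map_add, LinearMap.add_apply, ha, hb, add_zero]
      zero_mem' := by change φ 0 u = 0; rw [map_zero]; rfl
      smul_mem' := fun c x (hx : φ x u = 0) => by
        change φ (c * x) u = 0
        rw [hφmul, hx, map_zero] }
  have hI : ∀ s, s ∈ I ↔ φ s u = 0 := fun s => Iff.rfl
  have hgen : 1 - h' * h ∈ I := by
    rw [hI, map_sub, map_one, LinearMap.sub_apply, hφmul, hh, hh', Module.End.one_apply, sub_self]
  set x : S := star h * h - 1 with hx
  have hxs : star x = x := by rw [hx, star_sub, star_mul, star_star, star_one]
  let P : Submodule F S :=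
    { carrier := {s | ∃ a ∈ I, ∃ b ∈ I, s = a + star b}
      add_mem' := by
        rintro _ _ ⟨a, ha, b, hb, rfl⟩ ⟨a', ha', b', hb', rfl⟩
        exact ⟨a + a', I.add_mem ha ha', b + b', I.add_mem hb hb', by rw [star_add]; abel⟩
      zero_mem' := ⟨0, I.zero_mem, 0, I.zero_mem, by simp⟩
      smul_mem' := by
        rintro c _ ⟨a, ha, b, hb, rfl⟩
        refine ⟨c • a, ?_, c • b, ?_, by rw [smul_add, hstar_smul]⟩
        · rw [hI, map_smul, LinearMap.smul_apply, (hI a).1 ha, smul_zero]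
        · rw [hI, map_smul, LinearMap.smul_apply, (hI b).1 hb, smul_zero] }
  have hxP : x ∈ P := by
    by_contra hxP
    obtain ⟨l, hlx, hl⟩ := Submodule.exists_le_ker_of_notMem hxP
    let st : S →ₗ[F] S :=
      { toFun := star, map_add' := star_add, map_smul' := hstar_smul }
    let μ : S →ₗ[F] F := l + l ∘ₗ st
    have hμ : ∀ s, μ s = l s + l (star s) := fun s => rfl
    have hμs : ∀ s, μ (star s) = μ s := fun s => by rw [hμ, hμ, star_star, add_comm]
    have hlI : ∀ s ∈ I, l s = 0 := fun s hs => hl ⟨s, hs, 0, I.zero_mem, by simp⟩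
    have hlI' : ∀ s ∈ I, l (star s) = 0 := fun s hs => hl ⟨0, I.zero_mem, s, hs, by simp⟩
    have hμI : ∀ s ∈ I, μ s = 0 := fun s hs => by rw [hμ, hlI s hs, hlI' s hs, add_zero]
    set U := LinearMap.range (ev u) with hUdef
    obtain ⟨r₀, hr₀⟩ := LinearMap.exists_rightInverse_of_surjective (ev u).rangeRestrict
      (LinearMap.range_rangeRestrict _)
    obtain ⟨r, hr⟩ := LinearMap.exists_extend r₀
    have hrU : ∀ w ∈ U, φ (r w) u = w := by
      intro w hw
      have e1 : r w = r₀ ⟨w, hw⟩ := LinearMap.congr_fun hr ⟨w, hw⟩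
      have e3 := congrArg Subtype.val (LinearMap.congr_fun hr₀ ⟨w, hw⟩)
      rw [e1]
      exact e3
    let β : LinearMap.BilinForm F W :=
      LinearMap.mk₂ F (fun a b => μ (star (r b) * r a))
        (fun a a' b => by rw [map_add, mul_add, map_add])
        (fun c a b => by rw [map_smul, mul_smul_comm, map_smul])
        (fun a b b' => by rw [map_add, star_add, add_mul, map_add])
        (fun c a b => by rw [map_smul, hstar_smul, smul_mul_assoc, map_smul])
    have hβa : ∀ a b, β a b = μ (star (r b) * r a) := fun a b => rfl
    have hβsymm : ∀ a b, β a b = β b a := fun a b => by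
      rw [hβa, hβa, ← hμs, star_mul, star_star]
    have hβs : ∀ s t : S, β (φ s u) (φ t u) = μ (star t * s) := by
      have key : ∀ (s : S) (b : W), β (φ s u) b = μ (star (r b) * s) := by
        intro s b
        have e : r (φ s u) - s ∈ I := by
          rw [hI, map_sub, LinearMap.sub_apply, hrU (φ s u) ⟨s, rfl⟩, sub_self]
        have := hμI _ (I.mul_mem_left (star (r b)) e)
        rw [mul_sub, map_sub, sub_eq_zero] at this
        exact this
      intro s t
      have e : r (φ t u) - t ∈ I := by
        rw [hI, map_sub, LinearMap.sub_apply, hrU (φ t u) ⟨t, rfl⟩, sub_self]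
      have := hμI _ (I.mul_mem_left (star s) e)
      rw [mul_sub, map_sub, sub_eq_zero] at this
      rw [key, ← hμs, star_mul, star_star, this, ← hμs, star_mul, star_star]
    have hinv : ∀ g, ∀ a ∈ U, ∀ b ∈ U, β (τ g a) (τ g b) = β a b := by
      rintro g _ ⟨s, rfl⟩ _ ⟨t, rfl⟩
      rw [hev, hev, ← hφof, ← hφmul, ← hφmul, hβs, hβs, star_mul, hstar_of, mul_assoc,
        ← mul_assoc _ _ s, ← map_mul, inv_mul_cancel, map_one, one_mul]
    have hfinal := hβ U (hev_stable u) β hβsymm hinv (hev_self u) ⟨h, hh⟩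
    have e1 : β u u = μ 1 := by
      have := hβs 1 1
      rwa [map_one, Module.End.one_apply, star_one, mul_one] at this
    have e2 : β v v = μ (star h * h) := by
      have := hβs h h
      rwa [hh] at this
    have e3 : μ x = 0 := by rw [hx, map_sub, ← e1, ← e2, hfinal, sub_self]
    rw [hμ, hxs, ← two_mul] at e3
    exact hlx ((mul_eq_zero.1 e3).resolve_left h2)
  obtain ⟨a, ha, b, hb, hab⟩ := hxP
  obtain ⟨c, hc1, hcc, hcs⟩ := exists_half h2S
  have hsum : star h * h = 1 + c * (a + b) + star (c * (a + b)) := by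
    have e1 : star (c * (a + b)) = c * (star a + star b) := by
      rw [star_mul, hcs, star_add, hcc]
    have e2 : star x = star a + b := by rw [hab, star_add, star_star]
    have e3 : c * (a + b) + c * (star a + star b) = c * (x + star x) := by
      rw [e2, hab, ← mul_add]
      congr 1
      abel
    rw [e1, add_assoc, e3, hxs, mul_add, ← add_mul, hc1, one_mul, hx]
    abel
  obtain ⟨g, hg, hgg⟩ := exists_unitary_sub_mem h2S I hgen (I.mul_mem_left c (I.add_mem ha hb)) hsum
  refine ⟨g, star g, mul_eq_one_comm.1 hgg, hgg, ?_, fun x y => ?_⟩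
  · rw [hI, map_sub, LinearMap.sub_apply, hh, sub_eq_zero] at hg
    exact hg
  · rw [asAlgebraHom_adjoint B τ hτ]
    change B x (φ (star g) (φ g y)) = B x y
    rw [← hφmul, hgg, map_one, Module.End.one_apply]

end GroupAlgebra

section Separation

/-- A set of functions on a finite set which is closed under multiplication spans all functions
which it does not preclude. -/
theorem mem_span_of_separates {X : Type*} [Finite X] (M : Submonoid (X → ℂ)) (f : X → ℂ)
    (hf : ∀ x y, (∀ φ ∈ M, φ x = φ y) → f x = f y) : f ∈ Submodule.span ℂ (M : Set (X → ℂ)) := by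
  classical
  have := Fintype.ofFinite X
  let A : Subalgebra ℂ (X → ℂ) := Algebra.adjoin ℂ (M : Set (X → ℂ))
  have hA : Subalgebra.toSubmodule A = Submodule.span ℂ (M : Set (X → ℂ)) := by
    rw [Algebra.adjoin_eq_span, Submonoid.closure_eq]
  rw [← hA, Subalgebra.mem_toSubmodule]
  let R : Setoid X :=
    { r := fun x y => ∀ φ ∈ M, φ x = φ y
      iseqv := ⟨fun _ _ _ => rfl, fun h φ hφ => (h φ hφ).symm,
        fun h h' φ hφ => (h φ hφ).trans (h' φ hφ)⟩ }
  have hψ : ∀ x y, ∃ ψ ∈ A, (∀ z, R x z → ψ z = 1) ∧ (¬ R x y → ψ y = 0) := by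
    intro x y
    by_cases h : R x y
    · exact ⟨1, A.one_mem, fun _ _ => rfl, fun h' => absurd h h'⟩
    · obtain ⟨φ, hφ, hne⟩ : ∃ φ ∈ M, φ x ≠ φ y := by
        by_contra! h'
        exact h h'
      refine ⟨(φ x - φ y)⁻¹ • (φ - algebraMap ℂ _ (φ y)), ?_, fun z hz => ?_, fun _ => ?_⟩
      · exact A.smul_mem (A.sub_mem (Algebra.subset_adjoin hφ) (A.algebraMap_mem _)) _
      · have : φ x = φ z := hz φ hφ
        simp [← this, inv_mul_cancel₀ (sub_ne_zero.2 hne)]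
      · simp
  choose ψ hψA hψ1 hψ0 using hψ
  have key : f = ∑ q : Quotient R, f q.out • ∏ y, ψ q.out y := by
    funext z
    rw [Finset.sum_apply, Finset.sum_eq_single (Quotient.mk R z)]
    · have h1 : R (Quotient.mk R z).out z := Quotient.mk_out z
      rw [Pi.smul_apply, Finset.prod_apply, Finset.prod_eq_one fun y _ => hψ1 _ y z h1,
        smul_eq_mul, mul_one]
      exact (hf _ _ h1).symm
    · intro q _ hq
      have h1 : ¬ R q.out z := fun h => hq (by rw [← Quotient.out_eq q]; exact Quotient.sound h)
      have h3 : ∏ y, ψ q.out y z = 0 := Finset.prod_eq_zero (Finset.mem_univ z) (hψ0 _ z h1)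
      rw [Pi.smul_apply, Finset.prod_apply, h3, smul_zero]
    · simp
  rw [key]
  exact A.sum_mem fun q _ => A.smul_mem (A.prod_mem fun y _ => hψA _ _) _

end Separation

section Gaussian

variable {F W : Type*} [Field F] [AddCommGroup W] [Module F W]

open Classical in
/-- The Gaussian `w ↦ χ(½ β(w, w))` supported on a subspace `U`. -/
noncomputable def gaussian (χ : AddChar F ℂ) (U : Submodule F W) (β : LinearMap.BilinForm F W)
    (w : W) : ℂ :=
  if w ∈ U then χ ((2 : F)⁻¹ * β w w) else 0

variable {B : LinearMap.BilinForm F W}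

/-- `β` is a symmetric form invariant under `G` on the `G`-invariant subspace `U`. -/
structure IsInvariantPair (G : Subgroup (Sp B)) (U : Submodule F W)
    (β : LinearMap.BilinForm F W) : Prop where
  stable : ∀ g ∈ G, ∀ x ∈ U, (g : W ≃ₗ[F] W) x ∈ U
  symm : ∀ x ∈ U, ∀ y ∈ U, β x y = β y x
  invariant : ∀ g ∈ G, ∀ x ∈ U, ∀ y ∈ U, β ((g : W ≃ₗ[F] W) x) ((g : W ≃ₗ[F] W) y) = β x y

/-- The monoid of invariant Gaussians under pointwise multiplication. -/
noncomputable def gaussianMonoid (χ : AddChar F ℂ) (G : Subgroup (Sp B)) :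
    Submonoid (W → ℂ) where
  carrier := {f | ∃ U β, IsInvariantPair G U β ∧ f = gaussian χ U β}
  one_mem' := by
    refine ⟨⊤, 0, ⟨fun _ _ _ _ => trivial, fun _ _ _ _ => rfl, fun _ _ _ _ _ _ => rfl⟩, ?_⟩
    funext w
    simp [gaussian]
  mul_mem' := by
    rintro _ _ ⟨U, β, h, rfl⟩ ⟨U', β', h', rfl⟩
    refine ⟨U ⊓ U', β + β', ⟨fun g hg x hx => ⟨h.stable g hg x hx.1, h'.stable g hg x hx.2⟩,
      fun x hx y hy => ?_, fun g hg x hx y hy => ?_⟩, ?_⟩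
    · rw [LinearMap.add_apply, LinearMap.add_apply, LinearMap.add_apply, LinearMap.add_apply,
        h.symm x hx.1 y hy.1, h'.symm x hx.2 y hy.2]
    · rw [LinearMap.add_apply, LinearMap.add_apply, LinearMap.add_apply, LinearMap.add_apply,
        h.invariant g hg x hx.1 y hy.1, h'.invariant g hg x hx.2 y hy.2]
    · funext w
      by_cases hw : w ∈ U <;> by_cases hw' : w ∈ U' <;>
        simp [gaussian, hw, hw', mul_add, AddChar.map_add_eq_mul]

theorem gaussian_apply_smul {χ : AddChar F ℂ} {G : Subgroup (Sp B)} {U : Submodule F W}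
    {β : LinearMap.BilinForm F W} (h : IsInvariantPair G U β) {g : Sp B} (hg : g ∈ G) (w : W) :
    gaussian χ U β ((g : W ≃ₗ[F] W) w) = gaussian χ U β w := by
  have hiff : (g : W ≃ₗ[F] W) w ∈ U ↔ w ∈ U := by
    refine ⟨fun hw => ?_, h.stable g hg w⟩
    have h1 := h.stable g⁻¹ (G.inv_mem hg) _ hw
    rw [Subgroup.coe_inv, ← LinearEquiv.mul_apply, inv_mul_cancel] at h1
    exact h1
  by_cases hw : w ∈ U
  · rw [gaussian, gaussian, if_pos hw, if_pos (hiff.2 hw), h.invariant g hg w hw w hw]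
  · rw [gaussian, gaussian, if_neg hw, if_neg (hiff.not.2 hw)]

/-- Invariant Gaussians separate the orbits of a group which is a full centralizer. -/
theorem exists_mem_apply_eq_of_gaussianMonoid [Finite F] [Finite W] (h2 : (2 : F) ≠ 0)
    {χ : AddChar F ℂ} (hχ : χ ≠ 1) {G G' : Subgroup (Sp B)}
    (hG : G' = Subgroup.centralizer (G : Set (Sp B)))
    (hG' : G = Subgroup.centralizer (G' : Set (Sp B))) {u v : W}
    (h : ∀ f ∈ gaussianMonoid χ G, f u = f v) : ∃ g ∈ G, (g : W ≃ₗ[F] W) u = v := by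
  have hfinE : Finite (W ≃ₗ[F] W) := DFunLike.finite _
  let τ : Representation F G W :=
    LinearEquiv.automorphismGroup.toLinearMapMonoidHom.comp ((Sp B).subtype.comp G.subtype)
  have hτ : ∀ (g : G) x, τ g x = ((g : Sp B) : W ≃ₗ[F] W) x := fun g x => rfl
  have hχ0 : ∀ t, χ t ≠ 0 := fun t h0 => by
    have := χ.map_add_eq_mul t (-t)
    rw [h0, zero_mul, add_neg_cancel, AddChar.map_zero_eq_one] at this
    exact one_ne_zero this
  obtain ⟨s, t, hst, hts, hsu, hsB⟩ := exists_isometry_mem_groupAlgebra h2 B τ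
    (fun g x y => (g : Sp B).2 x y) (u := u) (v := v) (by
      intro U hU
      have h1 := h _ ⟨U, 0, ⟨fun g hg x hx => hU ⟨g, hg⟩ x hx, fun _ _ _ _ => rfl,
        fun _ _ _ _ _ _ => rfl⟩, rfl⟩
      simp only [gaussian, LinearMap.zero_apply, mul_zero, AddChar.map_zero_eq_one] at h1
      by_cases hu : u ∈ U <;> by_cases hv : v ∈ U
      · exact iff_of_true hu hv
      · rw [if_pos hu, if_neg hv] at h1
        exact absurd h1 one_ne_zero
      · rw [if_neg hu, if_pos hv] at h1
        exact absurd h1.symm one_ne_zero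
      · exact iff_of_false hu hv) (by
      intro U hU β hβ hinv hu hv
      by_contra hne
      obtain ⟨t, ht⟩ := exists_addChar_ne_one hχ (mul_ne_zero (inv_ne_zero h2) (sub_ne_zero.2 hne))
      have h1 := h _ ⟨U, t • β, ⟨fun g hg x hx => hU ⟨g, hg⟩ x hx,
        fun x _ y _ => by rw [LinearMap.smul_apply, LinearMap.smul_apply, LinearMap.smul_apply,
          LinearMap.smul_apply, hβ x y],
        fun g hg x hx y hy => by
          have := hinv ⟨g, hg⟩ x hx y hy
          rw [LinearMap.smul_apply, LinearMap.smul_apply, LinearMap.smul_apply,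
            LinearMap.smul_apply, ← this]
          rfl⟩, rfl⟩
      simp only [gaussian, if_pos hu, if_pos hv, LinearMap.smul_apply, smul_eq_mul] at h1
      apply ht
      have e : (2 : F)⁻¹ * (t * β u u) = t * ((2 : F)⁻¹ * (β u u - β v v)) +
        (2 : F)⁻¹ * (t * β v v) := by ring
      rw [e, AddChar.map_add_eq_mul] at h1
      exact mul_right_cancel₀ (hχ0 _) (h1.trans (one_mul _).symm))
  let γ : W ≃ₗ[F] W := LinearEquiv.ofLinearMap (τ.asAlgebraHom s) (τ.asAlgebraHom t)
    (by rw [← Module.End.mul_eq_comp, ← map_mul, hst, map_one]; rfl)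
    (by rw [← Module.End.mul_eq_comp, ← map_mul, hts, map_one]; rfl)
  have hγ : ∀ x, γ x = τ.asAlgebraHom s x := fun x => rfl
  refine ⟨⟨γ, fun x y => hsB x y⟩, ?_, hsu⟩
  rw [hG', Subgroup.mem_centralizer_iff]
  intro k hk
  have hcomm : ∀ r : MonoidAlgebra F G, ∀ x, (k : W ≃ₗ[F] W) (τ.asAlgebraHom r x) =
      τ.asAlgebraHom r ((k : W ≃ₗ[F] W) x) := by
    intro r x
    induction r using MonoidAlgebra.induction_on with
    | of g =>
      rw [Representation.asAlgebraHom_of, hτ, hτ, ← LinearEquiv.mul_apply, ← LinearEquiv.mul_apply,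
        ← Subgroup.coe_mul, ← Subgroup.coe_mul]
      rw [SetLike.mem_coe, hG, Subgroup.mem_centralizer_iff] at hk
      rw [hk g g.2]
    | add r r' hr hr' => simp only [map_add, LinearMap.add_apply, hr, hr']
    | smul c r hr => simp only [map_smul, LinearMap.smul_apply, hr]
  refine Subtype.ext (LinearEquiv.ext fun x => ?_)
  exact hcomm s x

/-- The Lagrangian relation attached to a Gaussian. -/
def gaussianRelation (B : LinearMap.BilinForm F W) (U : Submodule F W)
    (β : LinearMap.BilinForm F W) : Submodule F (W × W) where
  carrier := {u | u.2 - u.1 ∈ U ∧ ∀ x ∈ U, B (u.1 + u.2) x = 2 * β (u.2 - u.1) x}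
  add_mem' := by
    rintro a b ⟨h1, h2⟩ ⟨h1', h2'⟩
    refine ⟨?_, fun x hx => ?_⟩
    · rw [Prod.fst_add, Prod.snd_add, add_sub_add_comm]
      exact U.add_mem h1 h1'
    · rw [Prod.fst_add, Prod.snd_add, add_sub_add_comm, add_add_add_comm, map_add B,
        map_add β, LinearMap.add_apply, LinearMap.add_apply, h2 x hx, h2' x hx, mul_add]
  zero_mem' := by simp
  smul_mem' := by
    rintro c a ⟨h1, h2⟩
    refine ⟨?_, fun x hx => ?_⟩
    · rw [Prod.smul_fst, Prod.smul_snd, ← smul_sub]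
      exact U.smul_mem c h1
    · rw [Prod.smul_fst, Prod.smul_snd, ← smul_sub, ← smul_add, map_smul, map_smul,
        LinearMap.smul_apply, LinearMap.smul_apply, h2 x hx, smul_eq_mul, smul_eq_mul]
      ring

theorem gaussianRelation_isLagrangian [FiniteDimensional F W] (h2 : (2 : F) ≠ 0) (hB : B.IsAlt)
    (hN : B.Nondegenerate) {U : Submodule F W} {β : LinearMap.BilinForm F W}
    (hβ : ∀ x ∈ U, ∀ y ∈ U, β x y = β y x) :
    IsLagrangian (doubleForm B) (gaussianRelation B U β) := by
  rw [isLagrangian_iff_orthogonal_eq (doubleForm_isAlt hB)]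
  have hform : ∀ x y : W × W, 2 * doubleForm B x y =
      -(B (x.1 + x.2) (y.2 - y.1)) + B (y.1 + y.2) (x.2 - x.1) := by
    intro x y
    have e : ∀ a b : W, B a b = -B b a := fun a b => (hB.neg_eq b a).symm
    rw [doubleForm_apply]
    simp only [map_add, map_sub, LinearMap.add_apply]
    rw [e y.1 x.1, e y.1 x.2, e y.2 x.1, e y.2 x.2]
    ring
  refine le_antisymm (fun y hy => ?_) fun y hy x hx => ?_
  · have hy' : ∀ x ∈ gaussianRelation B U β,
        B (x.1 + x.2) (y.2 - y.1) = B (y.1 + y.2) (x.2 - x.1) := by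
      intro x hx
      have h1 := hform x y
      rw [hy x hx, mul_zero] at h1
      rw [eq_comm, ← sub_eq_zero, h1]
      ring
    have hU : y.2 - y.1 ∈ U := by
      rw [← LinearMap.BilinForm.orthogonal_orthogonal hN hB.isRefl U]
      intro m hm
      have hm' : ∀ x ∈ U, B m x = 0 := fun x hx => by rw [← hB.neg_eq, hm x hx, neg_zero]
      have h1 := hy' (m, m) ⟨by simp, fun x hx => by simp [hm' x hx]⟩
      simp only [map_add, LinearMap.add_apply, sub_self, map_zero, ← two_mul] at h1
      exact (mul_eq_zero.1 h1).resolve_left h2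
    refine ⟨hU, fun z hz => ?_⟩
    obtain ⟨m, hm⟩ : ∃ m, ∀ x, B m x = β z x :=
      ⟨(B.toDual hN).symm (β z), fun x => LinearMap.BilinForm.apply_toDual_symm_apply _ _⟩
    have hc : (2 : F)⁻¹ • z + (2 : F)⁻¹ • z = z := by
      rw [← add_smul, ← two_mul, mul_inv_cancel₀ h2, one_smul]
    have e1 : (m + (2 : F)⁻¹ • z) - (m - (2 : F)⁻¹ • z) = z := by
      rw [add_sub_sub_cancel, hc]
    have e2 : (m - (2 : F)⁻¹ • z) + (m + (2 : F)⁻¹ • z) = (2 : F) • m := by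
      rw [two_smul]; abel
    have h1 := hy' (m - (2 : F)⁻¹ • z, m + (2 : F)⁻¹ • z) ⟨by rw [e1]; exact hz, fun x _ => by
      rw [e1, e2, map_smul, LinearMap.smul_apply, hm, smul_eq_mul]⟩
    rw [e1, e2, map_smul, LinearMap.smul_apply, hm, smul_eq_mul, hβ z hz _ hU] at h1
    exact h1.symm
  · have h1 := hform x y
    rw [hx.2 _ hy.1, hy.2 _ hx.1, hβ _ hx.1 _ hy.1, neg_add_cancel] at h1
    exact (mul_eq_zero.1 h1).resolve_left h2

variable {V : Type*} [AddCommGroup V] [Module ℂ V] {ρ : Representation ℂ (Heisenberg B) V}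
  {χ : AddChar F ℂ}

/-- The operator with a given Weyl symbol. -/
noncomputable def weylOperator [Fintype W] (ρ : Representation ℂ (Heisenberg B) V) :
    (W → ℂ) →ₗ[ℂ] Module.End ℂ V :=
  ∑ w, (LinearMap.proj w : (W → ℂ) →ₗ[ℂ] ℂ).smulRight (ρ ⟨w, 0⟩)

theorem weylOperator_apply [Fintype W] (f : W → ℂ) :
    weylOperator ρ f = ∑ w, f w • ρ ⟨w, 0⟩ := by
  simp [weylOperator, LinearMap.sum_apply]

theorem doubleAction_weylOperator_gaussian [Fintype W] (h2 : (2 : F) ≠ 0) (hB : B.IsAlt)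
    (hρ : HasCentralCharacter ρ χ) {U : Submodule F W} {β : LinearMap.BilinForm F W}
    (hβ : ∀ x ∈ U, ∀ y ∈ U, β x y = β y x) {u : W × W} (hu : u ∈ gaussianRelation B U β) :
    doubleAction ρ u (weylOperator ρ (gaussian χ U β)) = weylOperator ρ (gaussian χ U β) := by
  obtain ⟨hz, hm⟩ := hu
  rw [weylOperator_apply, ← doubleActionHom_apply, map_sum]
  conv_rhs => rw [← Equiv.sum_comp (Equiv.addRight (u.2 - u.1))]
  refine Finset.sum_congr rfl fun w _ => ?_
  rw [map_smul, doubleActionHom_apply, doubleAction, rho_mul hρ, smul_mul_assoc, rho_mul hρ,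
    smul_smul, smul_smul, Equiv.coe_addRight]
  have hv : u.2 + w + -u.1 = w + (u.2 - u.1) := by abel
  rw [hv]
  congr 1
  have hiff : w + (u.2 - u.1) ∈ U ↔ w ∈ U := Submodule.add_mem_iff_left _ hz
  by_cases hw : w ∈ U
  · rw [gaussian, gaussian, if_pos hw, if_pos (hiff.2 hw), ← AddChar.map_add_eq_mul,
      ← AddChar.map_add_eq_mul]
    congr 1
    have e1 := hm w hw
    have e2 := hm _ hz
    have e3 := hβ _ hz _ hw
    have e4 : B w u.1 = -B u.1 w := (hB.neg_eq _ _).symm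
    have e5 : B u.1 u.2 = -B u.2 u.1 := (hB.neg_eq _ _).symm
    have e6 : β (w + (u.2 - u.1)) (w + (u.2 - u.1)) = β w w + 2 * β (u.2 - u.1) w +
        β (u.2 - u.1) (u.2 - u.1) := by
      generalize u.2 - u.1 = z at *
      rw [map_add β, LinearMap.add_apply, map_add, map_add, e3]; ring
    rw [map_add, LinearMap.add_apply] at e1
    rw [map_add, LinearMap.add_apply, map_sub, map_sub, hB.self_eq_zero, hB.self_eq_zero, e5] at e2
    have e7 : B u.2 u.1 = -β (u.2 - u.1) (u.2 - u.1) := by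
      have : 2 * (B u.2 u.1 + β (u.2 - u.1) (u.2 - u.1)) = 0 := by
        rw [mul_add, ← e2]; ring
      exact eq_neg_of_add_eq_zero_left ((mul_eq_zero.1 this).resolve_left h2)
    rw [e6, ← e1, map_add, LinearMap.add_apply, map_neg, map_neg, e4, e7]
    ring
  · rw [gaussian, gaussian, if_neg hw, if_neg (hiff.not.2 hw), zero_mul, zero_mul]

theorem omega_mul_rho {ω : Representation ℂ (Sp B) V} (hω : IsOscillatorRepresentation ρ ω)
    (g : Sp B) (w : W) : ω g * ρ ⟨w, 0⟩ = ρ ⟨(g : W ≃ₗ[F] W) w, 0⟩ * ω g := by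
  have h := hω g ⟨w, 0⟩
  change _ = ρ ⟨(g : W ≃ₗ[F] W) w, 0⟩ at h
  rw [← h, mul_assoc, ← map_mul, inv_mul_cancel, map_one, mul_one]

theorem weylOperator_gaussian_mem_span [Fintype W] [FiniteDimensional F W] (h2 : (2 : F) ≠ 0)
    (hB : B.IsAlt) (hN : B.Nondegenerate) (hρ : HasCentralCharacter ρ χ)
    {ω : Representation ℂ (Sp B) V} (hω : IsOscillatorRepresentation ρ ω) {G : Subgroup (Sp B)}
    {U : Submodule F W} {β : LinearMap.BilinForm F W} (h : IsInvariantPair G U β) :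
    weylOperator ρ (gaussian χ U β) ∈
      Submodule.span ℂ (oscillatorSemigroupInvariants ρ ω G) := by
  by_cases h0 : weylOperator ρ (gaussian χ U β) = 0
  · rw [h0]; exact Submodule.zero_mem _
  refine Submodule.subset_span ⟨⟨gaussianRelation B U β,
    gaussianRelation_isLagrangian h2 hB hN h.symm, h0, fun u hu =>
      doubleAction_weylOperator_gaussian h2 hB hρ h.symm hu⟩, fun g hg => ?_⟩
  rw [weylOperator_apply, Finset.mul_sum, Finset.sum_mul]
  conv_rhs => rw [← Equiv.sum_comp (g : W ≃ₗ[F] W).toEquiv]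
  refine Finset.sum_congr rfl fun w _ => ?_
  rw [mul_smul_comm, omega_mul_rho hω, smul_mul_assoc]
  congr 1
  exact (gaussian_apply_smul h hg w).symm

/-- An operator commuting with `ω(G)` has a `G`-invariant Weyl symbol. -/
theorem exists_invariant_symbol [Fintype W] [FiniteDimensional ℂ V] (h2 : (2 : F) ≠ 0)
    (hB : B.IsAlt) (hN : B.Nondegenerate) (hχ : χ ≠ 1) (hIrr : ρ.IsIrreducible)
    (hρ : HasCentralCharacter ρ χ) {ω : Representation ℂ (Sp B) V}
    (hω : IsOscillatorRepresentation ρ ω) {G : Subgroup (Sp B)} {T : Module.End ℂ V}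
    (hT : ∀ g ∈ G, ω g * T = T * ω g) :
    ∃ f : W → ℂ, (∀ g ∈ G, ∀ w, f ((g : W ≃ₗ[F] W) w) = f w) ∧ T = weylOperator ρ f := by
  have hfinE : Finite (W ≃ₗ[F] W) := DFunLike.finite _
  have := Fintype.ofFinite G
  obtain ⟨a, ha⟩ := exists_eq_sum_rho h2 hB hN hχ hIrr hρ T
  have hconj : ∀ g : G, T = ∑ w, a (((g : Sp B) : W ≃ₗ[F] W) w) • ρ ⟨w, 0⟩ := by
    intro g
    have h1 : ω (g : Sp B) * (∑ w, a (((g : Sp B) : W ≃ₗ[F] W) w) • ρ ⟨w, 0⟩) =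
        T * ω (g : Sp B) := by
      rw [Finset.mul_sum, ha, Finset.sum_mul]
      conv_rhs => rw [← Equiv.sum_comp ((g : Sp B) : W ≃ₗ[F] W).toEquiv]
      refine Finset.sum_congr rfl fun w _ => ?_
      rw [mul_smul_comm, omega_mul_rho hω, smul_mul_assoc]
      rfl
    rw [← hT g g.2] at h1
    have h3 := congrArg (fun X => ω (g : Sp B)⁻¹ * X) h1
    simp only [← mul_assoc, ← map_mul, inv_mul_cancel, map_one, one_mul] at h3
    exact h3.symm
  have hcard : (Fintype.card G : ℂ) ≠ 0 := Nat.cast_ne_zero.2 Fintype.card_ne_zero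
  refine ⟨fun w => (Fintype.card G : ℂ)⁻¹ * ∑ g : G, a (((g : Sp B) : W ≃ₗ[F] W) w),
    fun k hk w => ?_, ?_⟩
  · simp only
    congr 1
    exact Equiv.sum_comp (Equiv.mulRight (⟨k, hk⟩ : G))
      fun g : G => a (((g : Sp B) : W ≃ₗ[F] W) w)
  · have h1 : (Fintype.card G : ℂ) • T = ∑ g : G, ∑ w, a (((g : Sp B) : W ≃ₗ[F] W) w) •
        ρ ⟨w, 0⟩ := by
      rw [← Finset.sum_congr rfl fun g _ => hconj g]
      simp [Nat.cast_smul_eq_nsmul]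
    rw [weylOperator_apply]
    simp_rw [mul_smul, Finset.sum_smul]
    rw [← Finset.smul_sum, Finset.sum_comm, ← h1, smul_smul, inv_mul_cancel₀ hcard, one_smul]

end Gaussian

end Oscillator

open Oscillator in
theorem theorem8p1p1
    {F W V : Type*} [Field F] [Finite F] (hF : ringChar F ≠ 2)
    [AddCommGroup W] [Module F W] [FiniteDimensional F W]
    (B : LinearMap.BilinForm F W) (hAlt : B.IsAlt) (hNondeg : B.Nondegenerate)
    [AddCommGroup V] [Module ℂ V]
    (χ : AddChar F ℂ) (hχ : χ ≠ 1)
    (ρ : Representation ℂ (Heisenberg B) V) (hIrr : ρ.IsIrreducible)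
    (hρ : HasCentralCharacter ρ χ)
    (ω : Representation ℂ (Sp B) V) (hω : IsOscillatorRepresentation ρ ω)
    (G G' : Subgroup (Sp B)) (hGG' : IsDualPair G G') :
    (∀ A ∈ oscillatorSemigroupInvariants ρ ω G, ∀ A' ∈ oscillatorSemigroupInvariants ρ ω G,
        A * A' ∈ oscillatorSemigroupInvariants ρ ω G) ∧
      Submodule.span ℂ (oscillatorSemigroupInvariants ρ ω G) =
        Subalgebra.toSubmodule (commutingAlgebra ω G) := by
  have h2 : (2 : F) ≠ 0 := Ring.two_ne_zero hF
  have : Finite W := Module.finite_of_finite F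
  have := Fintype.ofFinite W
  have : FiniteDimensional ℂ V := finiteDimensional_of_isIrreducible hIrr
  have hmem : ∀ T : Module.End ℂ V, T ∈ commutingAlgebra ω G ↔ ∀ g ∈ G, ω g * T = T * ω g := by
    intro T
    rw [commutingAlgebra, Subalgebra.mem_centralizer_iff, Set.forall_mem_image]
    rfl
  refine ⟨?_, le_antisymm (Submodule.span_le.2 fun A hA => ?_) fun T hT => ?_⟩
  · rintro A ⟨hA, hAG⟩ A' ⟨hA', hAG'⟩
    refine ⟨mul_mem_oscillatorSemigroup h2 hAlt hNondeg hχ hIrr hρ hA hA', fun g hg => ?_⟩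
    rw [← mul_assoc, hAG g hg, mul_assoc, hAG' g hg, mul_assoc]
  · exact (hmem A).2 hA.2
  · obtain ⟨f, hf, rfl⟩ := exists_invariant_symbol h2 hAlt hNondeg hχ hIrr hρ hω ((hmem T).1 hT)
    have hspan : f ∈ Submodule.span ℂ (gaussianMonoid χ G : Set (W → ℂ)) := by
      refine mem_span_of_separates _ f fun x y hxy => ?_
      obtain ⟨g, hg, rfl⟩ := exists_mem_apply_eq_of_gaussianMonoid h2 hχ hGG'.1 hGG'.2 hxy
      exact (hf g hg x).symm
    have hle : Submodule.span ℂ (gaussianMonoid χ G : Set (W → ℂ)) ≤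
        (Submodule.span ℂ (oscillatorSemigroupInvariants ρ ω G)).comap (weylOperator ρ) := by
      refine Submodule.span_le.2 ?_
      rintro _ ⟨U, β, h, rfl⟩
      exact weylOperator_gaussian_mem_span h2 hAlt hNondeg hρ hω h
    exact hle hspan
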